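/- Let $T>0$ and let $\alpha:[0,T]\to[0,1]$ be continuous and decreasing with $\alpha_0=1$, $\alpha_T=0$, and differentiable on $(0,T)$ outside a countable set. Let $\mathbf F_\tau=\tfrac12\frac{d\log\alpha_\tau}{d\tau}\mathbf I_d$ and $\mathbf G_\tau=\sqrt{-\frac{d\log\alpha_\tau}{d\tau}}\,\mathbf I_d$, let $\lambda\ge 0$, let $\epsilon_\theta:\mathbb R^d\times[0,T]\to\mathbb R^d$, and put $\mathbf s_\theta(\mathbf u,\tau)=-\epsilon_\theta(\mathbf u,\tau)/\sqrt{1-\alpha_\tau}$. Let $\Delta t>0$ and $0\le t-\Delta t<t\le T$ be such that $\alpha_t>0$ and $\alpha_\tau<1$ for all $\tau\in(t-\Delta t,t]$. For a starting value $\mathbf u(t)$ define the approximate score $$\tilde{\mathbf s}(\mathbf u,\tau)=\frac{1-\alpha_t}{1-\alpha_\tau}\sqrt{\frac{\alpha_\tau}{\alpha_t}}\,\mathbf s_\theta(\mathbf u(t),t)-\frac{1}{1-\alpha_\tau}\Big(\mathbf u-\sqrt{\frac{\alpha_\tau}{\alpha_t}}\,\mathbf u(t)\Big),\qquad \tau\in[t-\Delta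 t,t].$$ Let $\mathbf u(\tau)$ be a solution with continuous paths, run backward in time from $t$ to $t-\Delta t$ and started at a (possibly random) $\mathbf u(t)$ independent of the noise, of $$d\mathbf u=\Big[\mathbf F_\tau\mathbf u-\frac{1+\lambda^2}{2}\mathbf G_\tau\mathbf G_\tau^{T}\,\tilde{\mathbf s}(\mathbf u,\tau)\Big]d\tau+\lambda\mathbf G_\tau\,d\mathbf w,$$ where $\mathbf w$ is a standard $d$-dimensional Wiener process running backward in time. Set $$\sigma_t^2=(1-\alpha_{t-\Delta t})\left[1-\Big(\frac{1-\alpha_{t-\Delta t}}{1-\alpha_t}\Big)^{\lambda^2}\Big(\frac{\alpha_t}{\alpha_{t-\Delta t}}\Big)^{\lambda^2}\right].$$ Then $0\le\sigma_t^2\le 1-\alpha_{t-\Delta t}$, and, conditionally on $\mathbf u(t)$, $$\mathbf u(t-\Delta t)\sim\mathcal N\!\left(\sqrt{\frac{\alpha_{t-\Delta t}}{\alpha_t}}\,\mathbf u(t)+\Big[-\sqrt{\frac{\alpha_{t-\Delta t}}{\alpha_t}}\sqrt{1-\alpha_t}+\sqrt{1-\alpha_{t-\Delta t}-\sigma_t^2}\Big]\epsilon_\theta(\mathbf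 u(t),t),\ \sigma_t^2\mathbf I_d\right).$$ This is the law of one stochastic DDIM step $$\sqrt{\frac{\alpha_{t-\Delta t}}{\alpha_t}}\,\mathbf u(t)+\Big(\sqrt{1-\alpha_{t-\Delta t}-\sigma_t^2}-\sqrt{1-\alpha_t}\sqrt{\frac{\alpha_{t-\Delta t}}{\alpha_t}}\Big)\epsilon_\theta(\mathbf u(t),t)+\sigma_t\,\epsilon,$$ given $\mathbf u(t)$, where $\epsilon\sim\mathcal N(0,\mathbf I_d)$ is independent of $\mathbf u(t)$. -/

import Mathlib

open MeasureTheory ProbabilityTheory Filter Topology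
open scoped NNReal ENNReal

noncomputable section

namespace DDIM

variable {Ω : Type*} [MeasurableSpace Ω] {d : ℕ}

/-- The state space `ℝ^d` with its Euclidean norm. -/
abbrev State (d : ℕ) : Type := EuclideanSpace ℝ (Fin d)

/-! ### Brownian motion in `ℝ^d` and the Wiener integral -/

/-- A standard Brownian motion in `ℝ^d`: the coordinates are independent real Brownian motions
(as processes). -/
structure IsStandardBrownian (W : ℝ≥0 → Ω → State d) (P : Measure Ω) : Prop where
  coord : ∀ i, IsBrownianReal (fun r ω => W r ω i) P
  indep : iIndepFun (fun (i : Fin d) (ω : Ω) (r : ℝ≥0) => W r ω i) P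

/-- A deterministic step function on `[0, ∞)`: it takes the value `val k` on
`(knot k, knot (k + 1)]` for `k < n`, and is `0` elsewhere. -/
structure StepFn where
  n : ℕ
  knot : ℕ → ℝ≥0
  mono : Monotone knot
  val : ℕ → ℝ

/-- The step function as a function on the real line. -/
def StepFn.eval (φ : StepFn) (r : ℝ) : ℝ :=
  ∑ k ∈ Finset.range φ.n,
    (Set.Ioc (φ.knot k : ℝ) (φ.knot (k + 1) : ℝ)).indicator (fun _ => φ.val k) r

/-- The elementary stochastic integral `∫₀ᵃ φ dB` of a step function. -/
def StepFn.integral (φ : StepFn) (B : ℝ≥0 → Ω → ℝ) (a : ℝ≥0) (ω : Ω) : ℝ :=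
  ∑ k ∈ Finset.range φ.n,
    φ.val k * (B (min (φ.knot (k + 1)) a) ω - B (min (φ.knot k) a) ω)

/-- `I = ∫₀ᵃ g(r) dB_r`, the Wiener (Itô) integral of the deterministic function `g`: the limit in
`L²(P)` of the elementary integrals of step functions that converge to `g` in `L²(0, a)`. -/
def IsWienerIntegral (P : Measure Ω) (B : ℝ≥0 → Ω → ℝ) (g : ℝ → ℝ) (a : ℝ≥0) (I : Ω → ℝ) : Prop :=
  MemLp I 2 P ∧ ∃ φ : ℕ → StepFn,
    Tendsto (fun n => eLpNorm (fun r => g r - (φ n).eval r) 2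
      (volume.restrict (Set.Ioc (0 : ℝ) (a : ℝ)))) atTop (𝓝 0) ∧
    Tendsto (fun n => eLpNorm (fun ω => (φ n).integral B a ω - I ω) 2 P) atTop (𝓝 0)

/-- `I = ∫₀ᵃ A(r) dW_r` for a deterministic matrix-valued integrand `A` and a process `W` in `ℝ^d`:
the `i`-th coordinate of `I` is `∑ j, ∫₀ᵃ A(r) i j dW^j_r`. -/
def IsMatrixWienerIntegral (P : Measure Ω) (W : ℝ≥0 → Ω → State d)
    (A : ℝ → Matrix (Fin d) (Fin d) ℝ) (a : ℝ≥0) (I : Ω → State d) : Prop :=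
  ∃ J : Fin d → Fin d → Ω → ℝ,
    (∀ i j, IsWienerIntegral P (fun r ω => W r ω j) (fun r => A r i j) a (J i j)) ∧
    ∀ i, ∀ᵐ ω ∂P, I ω i = ∑ j, J i j ω

/-! ### The λ-family of denoising SDEs -/

/-- The drift `F_τ x - (1 + λ²)/2 · G_τ G_τᵀ s(x, τ)`. -/
def lambdaDrift (F G : ℝ → Matrix (Fin d) (Fin d) ℝ) (lam : ℝ) (s : State d → ℝ → State d)
    (x : State d) (τ : ℝ) : State d :=
  Matrix.toEuclideanCLM (𝕜 := ℝ) (F τ) x -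
    ((1 + lam ^ 2) / 2) • Matrix.toEuclideanCLM (𝕜 := ℝ) (G τ * (G τ).transpose) (s x τ)

/-- `u` solves, backward in time from `t` down to `t - Δ`, the equation
`du = [F_τ u - (1 + λ²)/2 · G_τ G_τᵀ s(u, τ)] dτ + λ G_τ dw`,
where `w` is a Wiener process running backward in time, `w_τ - w_t = W_{t - τ}` for a standard
Brownian motion `W`. In integral form, for `τ ∈ [t - Δ, t]`,
`u_τ = u_t + ∫_t^τ drift dq + ∫_0^{t - τ} λ G_{t - r} dW_r`.
The starting value `u_t` may be random, independent of `W`; the score field `s ω` may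
depend on the outcome `ω`, as it does when it is built from `u_t`. -/
structure IsLambdaSDESolution (P : Measure Ω) (F G : ℝ → Matrix (Fin d) (Fin d) ℝ) (lam : ℝ)
    (s : Ω → State d → ℝ → State d) (t Δ : ℝ) (W : ℝ≥0 → Ω → State d)
    (u : ℝ → Ω → State d) : Prop where
  brownian : IsStandardBrownian W P
  indep_start : IndepFun (u t) (fun ω (r : ℝ≥0) => W r ω) P
  aemeasurable : ∀ τ ∈ Set.Icc (t - Δ) t, AEMeasurable (u τ) P
  continuous_paths : ∀ᵐ ω ∂P, ContinuousOn (fun τ => u τ ω) (Set.Icc (t - Δ) t)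
  drift_integrable : ∀ᵐ ω ∂P,
    IntervalIntegrable (fun q => lambdaDrift F G lam (s ω) (u q ω) q) volume (t - Δ) t
  equation : ∀ τ ∈ Set.Icc (t - Δ) t, ∃ I : Ω → State d,
    IsMatrixWienerIntegral P W (fun r => lam • G (t - r)) (t - τ).toNNReal I ∧
    ∀ᵐ ω ∂P, u τ ω = u t ω + (∫ q in t..τ, lambdaDrift F G lam (s ω) (u q ω) q) + I ω

/-! ### DDPM coefficients, scores and the DDIM update -/

/-- A DDPM noise schedule on `[0, T]`: `α` is decreasing from `α 0 = 1` to `α T = 0`. It is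
continuous, and differentiable off a countable set, so that piecewise differentiable schedules
are allowed. -/
structure IsDDPMSchedule (α : ℝ → ℝ) (T : ℝ) : Prop where
  T_pos : 0 < T
  antitone : AntitoneOn α (Set.Icc 0 T)
  at_zero : α 0 = 1
  at_end : α T = 0
  continuous : ContinuousOn α (Set.Icc 0 T)
  differentiable : ∃ S : Set ℝ, S.Countable ∧ ∀ τ ∈ Set.Ioo 0 T \ S, DifferentiableAt ℝ α τ

/-- `F_τ = (1/2) (d log α_τ / dτ) I_d`. -/
def ddpmF (d : ℕ) (α : ℝ → ℝ) (τ : ℝ) : Matrix (Fin d) (Fin d) ℝ :=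
  (1 / 2 * deriv (fun q => Real.log (α q)) τ) • (1 : Matrix (Fin d) (Fin d) ℝ)

/-- `G_τ = √(- d log α_τ / dτ) I_d`. -/
def ddpmG (d : ℕ) (α : ℝ → ℝ) (τ : ℝ) : Matrix (Fin d) (Fin d) ℝ :=
  √(-deriv (fun q => Real.log (α q)) τ) • (1 : Matrix (Fin d) (Fin d) ℝ)

/-- The parameterization `s_θ(x, τ) = - ε_θ(x, τ) / √(1 - α_τ)`. -/
def score (α : ℝ → ℝ) (eps : State d → ℝ → State d) (x : State d) (τ : ℝ) : State d :=
  -((1 / √(1 - α τ)) • eps x τ)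

/-- The approximation of the score at `(x, τ)` built from the single evaluation at
`(y, t)`, `y = u(t)`:
`(1 - α_t)/(1 - α_τ) √(α_τ/α_t) s_θ(y, t) - (x - √(α_τ/α_t) y)/(1 - α_τ)`. -/
def approxScore (α : ℝ → ℝ) (eps : State d → ℝ → State d) (t : ℝ) (y x : State d) (τ : ℝ) :
    State d :=
  ((1 - α t) / (1 - α τ) * √(α τ / α t)) • score α eps y t -
    (1 / (1 - α τ)) • (x - √(α τ / α t) • y)

/-- The variance `σ_t²` of the step from `t` to `t'`. -/
def stepVar (α : ℝ → ℝ) (lam t t' : ℝ) : ℝ :=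
  (1 - α t') * (1 - ((1 - α t') / (1 - α t)) ^ (lam ^ 2) * (α t / α t') ^ (lam ^ 2))

/-- The mean of the step from `t` to `t'`, started at `y`, with `v = σ_t²`. -/
def stepMean (α : ℝ → ℝ) (eps : State d → ℝ → State d) (v t t' : ℝ) (y : State d) : State d :=
  √(α t' / α t) • y + (-(√(α t' / α t) * √(1 - α t)) + √(1 - α t' - v)) • eps y t

/-- One step of stochastic DDIM from `t` to `t'`, from the state `y`, with noise level
`sigma` and noise `z` (a standard Gaussian sample). -/
def ddimUpdate (α : ℝ → ℝ) (eps : State d → ℝ → State d) (sigma t t' : ℝ) (y z : State d) :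
    State d :=
  √(α t' / α t) • y + (√(1 - α t' - sigma ^ 2) - √(1 - α t) * √(α t' / α t)) • eps y t + sigma • z

end DDIM

end

/-! ### Characteristic functions and limits -/

/-! Write `r = t - τ`, `L r = log α (t - r)` and `γ = L' ≥ 0`. With `y = u_t - √(1 - α_t) ε_θ(u_t,
t)` the approximate score equals `-(x - √(α_τ/α_t) y)/(1 - α_τ)`, so given `u_t` the equation is
linear. The curve `√(α_τ/α_t) y` solves it without noise, and each coordinate of the deviation `D`
from this curve satisfies `dD = ρ(L) γ D dr + λ √γ dW` with `ρ = rateFundamental`. If `θ' = ρ` and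
`K = exp (-θ(L))`, then `K D` has increments `K λ √γ dW`. Hence `D(R) = exp(θ) D(0)` plus a centered
Gaussian independent of `u_t`, of variance `exp(2θ) ∫ K² λ² γ dr` in each coordinate. Both `θ` and
this integral have closed forms in `log α`: the first turns `√(1 - α_t)` into `√(1 - α_{t-R} - σ²)`
(`exp_logFundamental_mul_sqrt`), the second gives `σ²` (`sq_exp_logFundamental_mul_variance`).

Itô calculus is avoided because the integrands are deterministic. `∫ K dN`, with `N` the noise part,
is approximated by the sums `∑ K ΔN` on uniform grids. Pathwise, summation by parts gives the limit
`K(R) D(R) - K(0) D(0)` (`tendsto_sum_integratingFactor`). In law, each sum is a Wiener integral,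
whose characteristic function jointly with `u_t` is explicit by the isometry
(`integral_cexp_add_sum_isonormal`). Comparing the two limits gives `integral_cexp_linear`.

If `α_{t-Δ} = 1` the rate `ρ` blows up at the end of the interval. The formula is therefore proved
for `R < Δ` (`integral_cexp_solution`) and extended to `Δ` by continuity of the paths. The joint
characteristic function then shows that `u_{t-Δ}` minus its conditional mean is Gaussian and
independent of `u_t`, which yields the conditional law. -/

lemma charFun_map_one_eq_integral {Ω : Type*} [MeasurableSpace Ω] {P : Measure Ω} {S : Ω → ℝ}
    (hS : AEMeasurable S P) :
    charFun (P.map S) 1 = ∫ ω, Complex.exp (S ω * Complex.I) ∂P := by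
  rw [charFun_apply_real, integral_map hS (by fun_prop)]
  simp

lemma integrable_cexp_ofReal_mul_I {Ω : Type*} [MeasurableSpace Ω] {P : Measure Ω}
    [IsFiniteMeasure P] {S : Ω → ℝ} (hS : AEMeasurable S P) :
    Integrable (fun ω => Complex.exp (S ω * Complex.I)) P := by
  refine Integrable.of_bound (C := 1) ?_ (ae_of_all _ fun ω => ?_)
  · exact (Complex.continuous_exp.measurable.comp_aemeasurable
      ((Complex.measurable_ofReal.comp_aemeasurable hS).mul_const _)).aestronglyMeasurable
  · rw [Complex.norm_exp_ofReal_mul_I]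

/-- The map `x ↦ exp (i x)` is 1-Lipschitz, so it preserves `L¹` convergence. This handles limits of
elementary integrals. -/
lemma tendsto_integral_cexp_of_tendsto_eLpNorm {Ω : Type*} [MeasurableSpace Ω] {P : Measure Ω}
    [IsFiniteMeasure P] {S : ℕ → Ω → ℝ} {S' : Ω → ℝ} (hS : ∀ n, AEMeasurable (S n) P)
    (hS' : AEMeasurable S' P) (h : Tendsto (fun n => eLpNorm (S n - S') 1 P) atTop (𝓝 0)) :
    Tendsto (fun n => ∫ ω, Complex.exp (S n ω * Complex.I) ∂P) atTop
      (𝓝 (∫ ω, Complex.exp (S' ω * Complex.I) ∂P)) := by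
  refine tendsto_integral_of_L1 _ (integrable_cexp_ofReal_mul_I hS').aestronglyMeasurable
    (Eventually.of_forall fun n => integrable_cexp_ofReal_mul_I (hS n)) ?_
  refine tendsto_of_tendsto_of_tendsto_of_le_of_le tendsto_const_nhds h (fun _ => zero_le)
    fun n => ?_
  simp only [eLpNorm_one_eq_lintegral_enorm]
  refine lintegral_mono fun ω => ?_
  have key : Complex.exp (S n ω * Complex.I) - Complex.exp (S' ω * Complex.I) =
      Complex.exp (S' ω * Complex.I) *
        (Complex.exp (Complex.I * ((S n ω - S' ω : ℝ) : ℂ)) - 1) := by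
    rw [mul_sub, ← Complex.exp_add, mul_one]
    congr 2
    push_cast
    ring
  rw [key, enorm_mul, mul_comm _ Complex.I, Complex.enorm_exp_I_mul_ofReal, one_mul]
  exact Real.enorm_exp_I_mul_ofReal_sub_one_le

/-- Dominated convergence with the bound `1`. This handles limits taken along paths, where no moment
bound is at hand. -/
lemma tendsto_integral_cexp_of_ae {Ω : Type*} [MeasurableSpace Ω] {P : Measure Ω}
    [IsFiniteMeasure P] {S : ℕ → Ω → ℝ} {S' : Ω → ℝ} (hS : ∀ n, AEMeasurable (S n) P)
    (h : ∀ᵐ ω ∂P, Tendsto (fun n => S n ω) atTop (𝓝 (S' ω))) :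
    Tendsto (fun n => ∫ ω, Complex.exp (S n ω * Complex.I) ∂P) atTop
      (𝓝 (∫ ω, Complex.exp (S' ω * Complex.I) ∂P)) := by
  refine tendsto_integral_of_dominated_convergence (fun _ => 1)
    (fun n => (integrable_cexp_ofReal_mul_I (hS n)).aestronglyMeasurable) (integrable_const _)
    (fun n => ae_of_all _ fun ω => by rw [Complex.norm_exp_ofReal_mul_I]) ?_
  filter_upwards [h] with ω hω
  have : Continuous fun x : ℝ => Complex.exp (x * Complex.I) := by fun_prop
  exact (this.tendsto _).comp hω

lemma MeasureTheory.MemLp.integral_sq_eq_eLpNorm {Ω : Type*} [MeasurableSpace Ω] {μ : Measure Ω}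
    {f : Ω → ℝ} (hf : MemLp f 2 μ) : ∫ x, f x ^ 2 ∂μ = (eLpNorm f 2 μ).toReal ^ 2 := by
  have h := hf.eLpNorm_eq_integral_rpow_norm (by norm_num) (by norm_num)
  have h0 : 0 ≤ ∫ x, f x ^ 2 ∂μ := integral_nonneg fun x => sq_nonneg _
  simp only [ENNReal.toReal_ofNat, Real.rpow_ofNat, Real.norm_eq_abs, sq_abs] at h
  rw [h, ENNReal.toReal_ofReal (by positivity), ← Real.rpow_natCast, ← Real.rpow_mul h0]
  norm_num

lemma tendsto_integral_sq_of_tendsto_eLpNorm {Ω : Type*} [MeasurableSpace Ω] {μ : Measure Ω}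
    {f : ℕ → Ω → ℝ} {g : Ω → ℝ} (hf : ∀ n, MemLp (f n) 2 μ) (hg : MemLp g 2 μ)
    (h : Tendsto (fun n => eLpNorm (f n - g) 2 μ) atTop (𝓝 0)) :
    Tendsto (fun n => ∫ x, f n x ^ 2 ∂μ) atTop (𝓝 (∫ x, g x ^ 2 ∂μ)) := by
  have := ((Lp.tendsto_Lp_iff_tendsto_eLpNorm'' f hf g hg).2 h).norm.pow 2
  simpa only [Lp.norm_toLp, ← MemLp.integral_sq_eq_eLpNorm, hf, hg] using this

namespace DDIM

/-! ### Brownian motion as an isonormal process -/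

/-- The `L²` function that represents `B s`. -/
noncomputable def initialIndicator (s : ℝ≥0) : ℝ → ℝ :=
  (Set.Ioc (0 : ℝ) (s : ℝ)).indicator (fun _ => 1)

/-- The step function with coefficients `c`. -/
noncomputable abbrev elemFun (c : ℝ≥0 →₀ ℝ) : ℝ → ℝ :=
  Finsupp.linearCombination ℝ initialIndicator c

/-- The integral of the step function with coefficients `c`. -/
noncomputable abbrev elemIntegral {Ω : Type*} (B : ℝ≥0 → Ω → ℝ) (c : ℝ≥0 →₀ ℝ) : Ω → ℝ :=
  Finsupp.linearCombination ℝ B c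

lemma memLp_initialIndicator (s : ℝ≥0) : MemLp (initialIndicator s) 2 volume :=
  memLp_indicator_const 2 measurableSet_Ioc 1 (Or.inr (by simp))

lemma memLp_elemFun (c : ℝ≥0 →₀ ℝ) : MemLp (elemFun c) 2 volume := by
  rw [elemFun, Finsupp.linearCombination_apply, Finsupp.sum]
  exact memLp_finsetSum' _ fun s _ => (memLp_initialIndicator s).const_smul _

lemma elemIntegral_apply {Ω : Type*} (B : ℝ≥0 → Ω → ℝ) (c : ℝ≥0 →₀ ℝ) (ω : Ω) :
    elemIntegral B c ω = ∑ s ∈ c.support, c s * B s ω := by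
  simp [elemIntegral, Finsupp.linearCombination_apply, Finsupp.sum]

lemma elemFun_apply (c : ℝ≥0 →₀ ℝ) (r : ℝ) :
    elemFun c r = ∑ s ∈ c.support, c s * initialIndicator s r := by
  simp [elemFun, Finsupp.linearCombination_apply, Finsupp.sum]

/-- The value is the covariance of Brownian motion at times `s` and `r`; the Itô isometry below
rests on this agreement. -/
lemma integral_initialIndicator_mul (s r : ℝ≥0) :
    ∫ x, initialIndicator s x * initialIndicator r x = min s r := by
  have : (fun x => initialIndicator s x * initialIndicator r x) =
      (Set.Ioc (0 : ℝ) ((min s r : ℝ≥0) : ℝ)).indicator (fun _ => 1) := by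
    ext x
    simp only [initialIndicator, Set.indicator_apply, Set.mem_Ioc, NNReal.coe_min, le_min_iff]
    split_ifs <;> simp_all
  rw [this, integral_indicator_const _ measurableSet_Ioc]
  simp

lemma integral_elemFun_sq (c : ℝ≥0 →₀ ℝ) :
    ∫ x, elemFun c x ^ 2 =
      ∑ s ∈ c.support, ∑ r ∈ c.support, c s * c r * ((min s r : ℝ≥0) : ℝ) := by
  have hint : ∀ s r : ℝ≥0, Integrable fun x => initialIndicator s x * initialIndicator r x :=
    fun s r => (memLp_initialIndicator s).integrable_mul (memLp_initialIndicator r)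
  have : (fun x => elemFun c x ^ 2) = fun x => ∑ s ∈ c.support, ∑ r ∈ c.support,
      (c s * c r) * (initialIndicator s x * initialIndicator r x) := by
    ext x
    rw [elemFun_apply, sq, Finset.sum_mul_sum]
    exact Finset.sum_congr rfl fun s _ => Finset.sum_congr rfl fun r _ => by ring
  rw [this, integral_finsetSum _ fun s _ => integrable_finsetSum _ fun r _ =>
    (hint s r).const_mul _]
  refine Finset.sum_congr rfl fun s _ => ?_
  rw [integral_finsetSum _ fun r _ => (hint s r).const_mul _]
  refine Finset.sum_congr rfl fun r _ => ?_
  rw [integral_const_mul, integral_initialIndicator_mul]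

section Brownian

variable {Ω : Type*} [MeasurableSpace Ω] {P : Measure Ω} {B : ℝ≥0 → Ω → ℝ}

lemma memLp_elemIntegral (hB : IsPreBrownianReal B P) (c : ℝ≥0 →₀ ℝ) :
    MemLp (elemIntegral B c) 2 P := by
  rw [elemIntegral, Finsupp.linearCombination_apply, Finsupp.sum]
  exact memLp_finsetSum' _ fun s _ =>
    ((hB.isGaussianProcess.hasGaussianLaw_eval s).memLp_two).const_smul _

lemma integral_elemIntegral (hB : IsPreBrownianReal B P) (c : ℝ≥0 →₀ ℝ) :
    ∫ ω, elemIntegral B c ω ∂P = 0 := by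
  simp_rw [elemIntegral_apply]
  rw [integral_finsetSum _ fun s _ => (hB.integrable_eval s).const_mul _]
  simp_rw [integral_const_mul, hB.integral_eval]
  simp

lemma variance_elemIntegral (hB : IsPreBrownianReal B P) (c : ℝ≥0 →₀ ℝ) :
    Var[elemIntegral B c; P] = ∫ x, elemFun c x ^ 2 := by
  have := hB.isGaussianProcess.isProbabilityMeasure
  have h : elemIntegral B c = fun ω => ∑ s ∈ c.support, c s * B s ω :=
    funext fun ω => elemIntegral_apply B c ω
  rw [h, variance_fun_sum' (X := fun s ω => c s * B s ω) fun s _ =>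
    ((hB.isGaussianProcess.hasGaussianLaw_eval s).memLp_two).const_mul _, integral_elemFun_sq]
  refine Finset.sum_congr rfl fun s _ => Finset.sum_congr rfl fun r _ => ?_
  rw [covariance_const_mul_left, covariance_const_mul_right, hB.covariance_fun_eval]
  ring

lemma hasGaussianLaw_elemIntegral (hB : IsPreBrownianReal B P) (c : ℝ≥0 →₀ ℝ) :
    HasGaussianLaw (elemIntegral B c) P := by
  have h : elemIntegral B c = fun ω => ∑ s ∈ c.support, c s • B s ω :=
    funext fun ω => elemIntegral_apply B c ω
  rw [h]
  exact (hB.isGaussianProcess.smul c).hasGaussianLaw_fun_sum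

lemma charFun_elemIntegral (hB : IsPreBrownianReal B P) (c : ℝ≥0 →₀ ℝ) :
    charFun (P.map (elemIntegral B c)) 1 =
      Complex.exp (-(((∫ x, elemFun c x ^ 2) / 2 : ℝ) : ℂ)) := by
  rw [(hasGaussianLaw_elemIntegral hB c).map_eq_gaussianReal, charFun_gaussianReal,
    integral_elemIntegral hB, variance_elemIntegral hB,
    Real.coe_toNNReal _ (integral_nonneg fun x => sq_nonneg _)]
  congr 1
  push_cast
  ring

/-- The Itô isometry on step functions: elementary integrals are centered, so their second moment is
their variance. -/
lemma eLpNorm_elemIntegral (hB : IsPreBrownianReal B P) (c : ℝ≥0 →₀ ℝ) :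
    eLpNorm (elemIntegral B c) 2 P = eLpNorm (elemFun c) 2 volume := by
  have h1 := (memLp_elemIntegral hB c).integral_sq_eq_eLpNorm
  have h2 := (memLp_elemFun c).integral_sq_eq_eLpNorm
  have h3 := variance_elemIntegral hB c
  rw [variance_of_integral_eq_zero (memLp_elemIntegral hB c).aemeasurable
    (integral_elemIntegral hB c), h2] at h3
  have h1' : ∫ ω, elemIntegral B c ω ^ 2 ∂P = (eLpNorm (elemFun c) 2 volume).toReal ^ 2 := h3
  rw [h1] at h1'
  refine (ENNReal.toReal_eq_toReal_iff' (memLp_elemIntegral hB c).2.ne (memLp_elemFun c).2.ne).1 ?_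
  exact (sq_eq_sq₀ ENNReal.toReal_nonneg ENNReal.toReal_nonneg).1 h1'

/-- `X` is the value at `f ∈ L²(ℝ)` of the isonormal process generated by `B`. -/
structure IsIsonormalValue (P : Measure Ω) (B : ℝ≥0 → Ω → ℝ) (f : ℝ → ℝ) (X : Ω → ℝ) : Prop where
  memLp_fun : MemLp f 2 volume
  memLp_val : MemLp X 2 P
  approx : ∃ c : ℕ → ℝ≥0 →₀ ℝ,
    Tendsto (fun n => eLpNorm (elemFun (c n) - f) 2 volume) atTop (𝓝 0) ∧
    Tendsto (fun n => eLpNorm (elemIntegral B (c n) - X) 2 P) atTop (𝓝 0)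

namespace IsIsonormalValue

variable {f g : ℝ → ℝ} {X Y : Ω → ℝ}

lemma zero : IsIsonormalValue P B 0 0 where
  memLp_fun := MemLp.zero
  memLp_val := MemLp.zero
  approx := ⟨fun _ => 0, by simp⟩

lemma add (hB : IsPreBrownianReal B P) (hX : IsIsonormalValue P B f X)
    (hY : IsIsonormalValue P B g Y) : IsIsonormalValue P B (f + g) (X + Y) := by
  obtain ⟨c, hc1, hc2⟩ := hX.approx
  obtain ⟨e, he1, he2⟩ := hY.approx
  refine ⟨hX.memLp_fun.add hY.memLp_fun, hX.memLp_val.add hY.memLp_val, fun n => c n + e n, ?_, ?_⟩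
  · have := hc1.add he1
    rw [add_zero] at this
    refine tendsto_of_tendsto_of_tendsto_of_le_of_le tendsto_const_nhds this (fun _ => zero_le)
      fun n => ?_
    simp only [elemFun, map_add, add_sub_add_comm]
    exact eLpNorm_add_le ((memLp_elemFun _).1.sub hX.memLp_fun.1)
      ((memLp_elemFun _).1.sub hY.memLp_fun.1) (by norm_num)
  · have := hc2.add he2
    rw [add_zero] at this
    refine tendsto_of_tendsto_of_tendsto_of_le_of_le tendsto_const_nhds this (fun _ => zero_le)
      fun n => ?_
    simp only [elemIntegral, map_add, add_sub_add_comm]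
    exact eLpNorm_add_le ((memLp_elemIntegral hB _).1.sub hX.memLp_val.1)
      ((memLp_elemIntegral hB _).1.sub hY.memLp_val.1) (by norm_num)

lemma smul (hX : IsIsonormalValue P B f X) (a : ℝ) : IsIsonormalValue P B (a • f) (a • X) := by
  obtain ⟨c, hc1, hc2⟩ := hX.approx
  refine ⟨hX.memLp_fun.const_smul a, hX.memLp_val.const_smul a, fun n => a • c n, ?_, ?_⟩
  · simp only [elemFun, map_smul, ← smul_sub, eLpNorm_const_smul]
    simpa using ENNReal.Tendsto.const_mul hc1 (Or.inr enorm_ne_top)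
  · simp only [elemIntegral, map_smul, ← smul_sub, eLpNorm_const_smul]
    simpa using ENNReal.Tendsto.const_mul hc2 (Or.inr enorm_ne_top)

lemma sub (hB : IsPreBrownianReal B P) (hX : IsIsonormalValue P B f X)
    (hY : IsIsonormalValue P B g Y) : IsIsonormalValue P B (f - g) (X - Y) := by
  have := hX.add hB (hY.smul (-1))
  simpa [sub_eq_add_neg] using this

lemma sum (hB : IsPreBrownianReal B P) {ι : Type*} (s : Finset ι) {f : ι → ℝ → ℝ} {X : ι → Ω → ℝ}
    (h : ∀ i ∈ s, IsIsonormalValue P B (f i) (X i)) :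
    IsIsonormalValue P B (∑ i ∈ s, f i) (∑ i ∈ s, X i) := by
  classical
  induction s using Finset.induction_on with
  | empty => simpa using zero
  | insert a s ha ih =>
    rw [Finset.sum_insert ha, Finset.sum_insert ha]
    exact (h a (Finset.mem_insert_self _ _)).add hB
      (ih fun i hi => h i (Finset.mem_insert_of_mem hi))

lemma congr_ae (hX : IsIsonormalValue P B f X) (hXY : X =ᵐ[P] Y) : IsIsonormalValue P B f Y := by
  obtain ⟨c, hc1, hc2⟩ := hX.approx
  refine ⟨hX.memLp_fun, hX.memLp_val.ae_eq hXY, c, hc1, ?_⟩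
  refine hc2.congr fun n => eLpNorm_congr_ae ?_
  filter_upwards [hXY] with ω hω
  simp [hω]

/-- By the isometry, the approximating integrals tend to `0` together with their integrands. Used to
discard the off-diagonal terms of the matrix integral. -/
lemma ae_eq_zero (hB : IsPreBrownianReal B P) (hX : IsIsonormalValue P B 0 X) : X =ᵐ[P] 0 := by
  obtain ⟨c, hc1, hc2⟩ := hX.approx
  have h1 : Tendsto (fun n => eLpNorm (elemIntegral B (c n)) 2 P) atTop (𝓝 0) := by
    simpa only [eLpNorm_elemIntegral hB, sub_zero] using hc1
  have h2 : ∀ n, eLpNorm X 2 P ≤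
      eLpNorm (elemIntegral B (c n)) 2 P + eLpNorm (elemIntegral B (c n) - X) 2 P := fun n => by
    have := eLpNorm_sub_le (p := 2) (memLp_elemIntegral hB (c n)).1
      ((memLp_elemIntegral hB (c n)).1.sub hX.memLp_val.1) (by norm_num)
    simpa using this
  have h3 := ge_of_tendsto' (h1.add hc2) h2
  rw [add_zero, nonpos_iff_eq_zero, eLpNorm_eq_zero_iff hX.memLp_val.1 (by norm_num)] at h3
  exact h3

end IsIsonormalValue

/-- The coefficients of a step function restricted to `(0, a]`. -/
noncomputable def StepFn.coeff (φ : StepFn) (a : ℝ≥0) : ℝ≥0 →₀ ℝ :=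
  ∑ k ∈ Finset.range φ.n,
    φ.val k • (Finsupp.single (min (φ.knot (k + 1)) a) 1 - Finsupp.single (min (φ.knot k) a) 1)

lemma elemIntegral_coeff {Ω : Type*} {B : ℝ≥0 → Ω → ℝ} (φ : StepFn) (a : ℝ≥0) :
    elemIntegral B (φ.coeff a) = φ.integral B a := by
  ext ω
  simp [elemIntegral, StepFn.coeff, StepFn.integral]

lemma elemFun_coeff (φ : StepFn) (a : ℝ≥0) :
    elemFun (φ.coeff a) = (Set.Ioc (0 : ℝ) (a : ℝ)).indicator φ.eval := by
  ext r
  simp only [elemFun, StepFn.coeff, map_sum, map_smul, map_sub, Finsupp.linearCombination_single,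
    one_smul, Finset.sum_apply, Pi.smul_apply, Pi.sub_apply, smul_eq_mul, StepFn.eval,
    Set.indicator_apply, initialIndicator, Set.mem_Ioc]
  by_cases h : 0 < r ∧ r ≤ (a : ℝ)
  · rw [if_pos h]
    refine Finset.sum_congr rfl fun k _ => ?_
    have hk : (φ.knot k : ℝ) ≤ φ.knot (k + 1) := by exact_mod_cast φ.mono (Nat.le_succ k)
    simp only [NNReal.coe_min, le_min_iff]
    grind
  · rw [if_neg h]
    refine Finset.sum_eq_zero fun k _ => ?_
    simp only [NNReal.coe_min, le_min_iff]
    grind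

/-- Stopping the knots at `a` cuts the step function off outside `(0, a]`, so integrals with
different end times become values of one linear process on `L²(ℝ)` and can be subtracted. -/
lemma IsWienerIntegral.isIsonormalValue {g : ℝ → ℝ} {a : ℝ≥0} {I : Ω → ℝ}
    (h : IsWienerIntegral P B g a I)
    (hg : MemLp ((Set.Ioc (0 : ℝ) (a : ℝ)).indicator g) 2 volume) :
    IsIsonormalValue P B ((Set.Ioc (0 : ℝ) (a : ℝ)).indicator g) I := by
  obtain ⟨hI, φ, h1, h2⟩ := h
  refine ⟨hg, hI, fun n => (φ n).coeff a, ?_, ?_⟩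
  · refine h1.congr fun n => ?_
    rw [elemFun_coeff, eLpNorm_sub_comm, ← Set.indicator_sub',
      eLpNorm_indicator_eq_eLpNorm_restrict measurableSet_Ioc]
    rfl
  · refine h2.congr fun n => ?_
    rw [elemIntegral_coeff]
    rfl

/-- The joint characteristic function of a random variable `Y` independent of a standard Brownian
motion in `ℝ^d` and of values of the isonormal processes of its coordinates. -/
lemma integral_cexp_add_sum_isonormal [IsProbabilityMeasure P] {d : ℕ} {W : ℝ≥0 → Ω → State d}
    (hW : IsStandardBrownian W P) {Y : Ω → ℝ} (hYm : AEMeasurable Y P)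
    (hY : IndepFun Y (fun ω (r : ℝ≥0) => W r ω) P) {f : Fin d → ℝ → ℝ} {X : Fin d → Ω → ℝ}
    (h : ∀ i, IsIsonormalValue P (fun r ω => W r ω i) (f i) (X i)) :
    ∫ ω, Complex.exp ((Y ω + ∑ i, X i ω : ℝ) * Complex.I) ∂P =
      (∫ ω, Complex.exp (Y ω * Complex.I) ∂P) *
        Complex.exp (-(((∑ i, ∫ x, f i x ^ 2) / 2 : ℝ) : ℂ)) := by
  have hB : ∀ i, IsPreBrownianReal (fun r ω => W r ω i) P :=
    fun i => (hW.coord i).toIsPreBrownianReal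
  choose c hc1 hc2 using fun i => (h i).approx
  set E : ℕ → Fin d → Ω → ℝ := fun n i => elemIntegral (fun r ω => W r ω i) (c i n) with hE
  have hEm : ∀ n i, AEMeasurable (E n i) P := fun n i => (memLp_elemIntegral (hB i) _).aemeasurable
  have hEsm : ∀ n, AEMeasurable (fun ω => ∑ i, E n i ω) P := fun n =>
    Finset.aemeasurable_fun_sum _ fun i _ => hEm n i
  have helem : ∀ n, ∫ ω, Complex.exp ((Y ω + ∑ i, E n i ω : ℝ) * Complex.I) ∂P =
      (∫ ω, Complex.exp (Y ω * Complex.I) ∂P) *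
        Complex.exp (-(((∑ i, ∫ x, elemFun (c i n) x ^ 2) / 2 : ℝ) : ℂ)) := by
    intro n
    -- An elementary integral is a measurable function of finitely many values of `W`, so
    -- independence of whole paths passes to it.
    have hind : IndepFun Y (fun ω => ∑ i, E n i ω) P := by
      have := hY.comp (φ := id) (ψ := fun w : ℝ≥0 → State d =>
        ∑ i, ∑ s ∈ (c i n).support, c i n s * w s i) measurable_id (by fun_prop)
      have heq : (fun ω => ∑ i, E n i ω) = (fun w : ℝ≥0 → State d =>
          ∑ i, ∑ s ∈ (c i n).support, c i n s * w s i) ∘ fun ω (r : ℝ≥0) => W r ω := by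
        ext ω
        simp only [hE, elemIntegral_apply, Function.comp]
      rw [heq]
      exact this
    have hiind : iIndepFun (E n) P := by
      have := hW.indep.comp (fun i (w : ℝ≥0 → ℝ) => ∑ s ∈ (c i n).support, c i n s * w s)
        (fun i => by fun_prop)
      convert this using 2 with i
      ext ω
      simp only [hE, elemIntegral_apply, Function.comp]
    rw [← charFun_map_one_eq_integral (S := fun ω => Y ω + ∑ i, E n i ω) (hYm.add (hEsm n)),
      hind.charFun_map_fun_add_eq_mul hYm (hEsm n), Pi.mul_apply, charFun_map_one_eq_integral hYm,
      hiind.charFun_map_fun_sum_eq_prod (hEm n), Finset.prod_apply]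
    congr 1
    simp_rw [hE, charFun_elemIntegral (hB _)]
    rw [← Complex.exp_sum]
    congr 1
    push_cast
    rw [Finset.sum_div, Finset.sum_neg_distrib]
  have hlhs : Tendsto (fun n => ∫ ω, Complex.exp ((Y ω + ∑ i, E n i ω : ℝ) * Complex.I) ∂P) atTop
      (𝓝 (∫ ω, Complex.exp ((Y ω + ∑ i, X i ω : ℝ) * Complex.I) ∂P)) := by
    refine tendsto_integral_cexp_of_tendsto_eLpNorm (fun n => hYm.add (hEsm n))
      (hYm.add (Finset.aemeasurable_fun_sum _ fun i _ => (h i).memLp_val.aemeasurable)) ?_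
    have hsum := tendsto_finsetSum Finset.univ fun i _ => hc2 i
    rw [Finset.sum_const_zero] at hsum
    refine tendsto_of_tendsto_of_tendsto_of_le_of_le tendsto_const_nhds hsum (fun _ => zero_le)
      fun n => ?_
    have hms : ∀ i, AEStronglyMeasurable (E n i - X i) P := fun i =>
      (hEm n i).aestronglyMeasurable.sub (h i).memLp_val.1
    have heq : ((fun ω => Y ω + ∑ i, E n i ω) - fun ω => Y ω + ∑ i, X i ω) =
        ∑ i, (E n i - X i) := by
      ext ω
      simp [Finset.sum_sub_distrib]
    rw [heq]
    refine (eLpNorm_sum_le (fun i _ => hms i) le_rfl).trans (Finset.sum_le_sum fun i _ => ?_)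
    exact eLpNorm_le_eLpNorm_of_exponent_le (by norm_num) (hms i)
  have hrhs : Tendsto (fun n => (∫ ω, Complex.exp (Y ω * Complex.I) ∂P) *
      Complex.exp (-(((∑ i, ∫ x, elemFun (c i n) x ^ 2) / 2 : ℝ) : ℂ))) atTop
      (𝓝 ((∫ ω, Complex.exp (Y ω * Complex.I) ∂P) *
        Complex.exp (-(((∑ i, ∫ x, f i x ^ 2) / 2 : ℝ) : ℂ)))) := by
    refine Tendsto.const_mul _ ?_
    have hsum : Tendsto (fun n => ∑ i, ∫ x, elemFun (c i n) x ^ 2) atTop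
        (𝓝 (∑ i, ∫ x, f i x ^ 2)) := tendsto_finsetSum _ fun i _ =>
      tendsto_integral_sq_of_tendsto_eLpNorm (fun n => memLp_elemFun _) (h i).memLp_fun (hc1 i)
    have hcont : Continuous fun v : ℝ => Complex.exp (-((v / 2 : ℝ) : ℂ)) := by fun_prop
    exact (hcont.tendsto _).comp hsum
  exact tendsto_nhds_unique hlhs (by simpa only [helem] using hrhs)

end Brownian

/-! ### Riemann–Stieltjes sums along uniform grids -/

/-- The `k`-th point of the uniform partition of `[0, R]` into `n + 1` intervals. -/
noncomputable def gridPoint (R : ℝ) (n k : ℕ) : ℝ := k * (R / (n + 1))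

lemma gridPoint_zero (R : ℝ) (n : ℕ) : gridPoint R n 0 = 0 := by simp [gridPoint]

lemma gridPoint_last (R : ℝ) (n : ℕ) : gridPoint R n (n + 1) = R := by
  rw [gridPoint]
  push_cast
  field_simp

lemma gridPoint_mono {R : ℝ} (hR : 0 ≤ R) (n : ℕ) : Monotone (gridPoint R n) := fun j k hjk => by
  rw [gridPoint, gridPoint]
  gcongr

lemma gridPoint_mem {R : ℝ} (hR : 0 ≤ R) {n k : ℕ} (hk : k ≤ n + 1) :
    gridPoint R n k ∈ Set.Icc 0 R :=
  ⟨(gridPoint_zero R n).symm.le.trans (gridPoint_mono hR n (Nat.zero_le k)),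
    (gridPoint_mono hR n hk).trans (gridPoint_last R n).le⟩

lemma gridPoint_succ_sub (R : ℝ) (n k : ℕ) :
    gridPoint R n (k + 1) - gridPoint R n k = R / (n + 1) := by
  rw [gridPoint, gridPoint]
  push_cast
  ring

lemma intervalIntegrable_gridPoint {R : ℝ} (hR : 0 ≤ R) {κ : ℝ → ℝ}
    (hκ : IntervalIntegrable κ volume 0 R) {n j k : ℕ} (hj : j ≤ n + 1) (hk : k ≤ n + 1) :
    IntervalIntegrable κ volume (gridPoint R n j) (gridPoint R n k) := by
  refine hκ.mono_set ?_
  rw [Set.uIcc_of_le hR]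
  exact Set.uIcc_subset_Icc (gridPoint_mem hR hj) (gridPoint_mem hR hk)

/-- Riemann–Stieltjes sums of a continuous function against an absolutely continuous integrator
converge. -/
lemma tendsto_sum_mul_sub {R : ℝ} (hR : 0 ≤ R) {f κ Φ : ℝ → ℝ} (hf : ContinuousOn f (Set.Icc 0 R))
    (hκ : IntervalIntegrable κ volume 0 R)
    (hΦ : ∀ r ∈ Set.Icc 0 R, ∫ x in (0 : ℝ)..r, κ x = Φ r - Φ 0)
    (tag : ℕ → ℕ → ℝ)
    (htag : ∀ n k, tag n k ∈ Set.Icc (gridPoint R n k) (gridPoint R n (k + 1))) :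
    Tendsto (fun n => ∑ k ∈ Finset.range (n + 1),
      f (tag n k) * (Φ (gridPoint R n (k + 1)) - Φ (gridPoint R n k))) atTop
      (𝓝 (∫ x in (0 : ℝ)..R, f x * κ x)) := by
  set M := ∫ x in (0 : ℝ)..R, |κ x| with hM
  have hM0 : 0 ≤ M := intervalIntegral.integral_nonneg hR fun x _ => abs_nonneg _
  have hfκ : IntervalIntegrable (fun x => f x * κ x) volume 0 R :=
    hκ.continuousOn_mul (by rwa [Set.uIcc_of_le hR])
  have hdiff : ∀ n k, k < n + 1 → Φ (gridPoint R n (k + 1)) - Φ (gridPoint R n k) =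
      ∫ x in (gridPoint R n k)..(gridPoint R n (k + 1)), κ x := by
    intro n k hk
    have h0 : (0 : ℝ) = gridPoint R n 0 := (gridPoint_zero R n).symm
    rw [← intervalIntegral.integral_interval_sub_left (a := 0)
      (h0 ▸ intervalIntegrable_gridPoint hR hκ (Nat.zero_le _) hk)
      (h0 ▸ intervalIntegrable_gridPoint hR hκ (Nat.zero_le _) hk.le),
      hΦ _ (gridPoint_mem hR hk), hΦ _ (gridPoint_mem hR hk.le)]
    ring
  rw [Metric.tendsto_atTop]
  intro ε hε
  have huc := isCompact_Icc.uniformContinuousOn_of_continuous hf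
  rw [Metric.uniformContinuousOn_iff] at huc
  -- The total error is at most the oscillation of `f` times `M = ∫ |κ|`; the `+ 1` covers `M = 0`
  -- and makes the final bound strict.
  obtain ⟨δ, hδ, hfδ⟩ := huc (ε / (M + 1)) (by positivity)
  obtain ⟨N, hN⟩ := exists_nat_gt (R / δ)
  refine ⟨N, fun n hn => ?_⟩
  have hmesh : R / (n + 1) < δ := by
    rw [div_lt_iff₀ (by positivity)]
    rw [div_lt_iff₀ hδ] at hN
    have : (N : ℝ) ≤ n := by exact_mod_cast hn
    nlinarith
  have hsplit : ∀ g : ℝ → ℝ, IntervalIntegrable g volume 0 R →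
      ∫ x in (0 : ℝ)..R, g x = ∑ k ∈ Finset.range (n + 1),
        ∫ x in (gridPoint R n k)..(gridPoint R n (k + 1)), g x := by
    intro g hg
    rw [intervalIntegral.sum_integral_adjacent_intervals fun k hk =>
      intervalIntegrable_gridPoint hR hg hk.le hk, gridPoint_zero, gridPoint_last]
  rw [Real.dist_eq, hsplit _ hfκ, ← Finset.sum_sub_distrib]
  calc _ ≤ ∑ k ∈ Finset.range (n + 1), ε / (M + 1) *
        ∫ x in (gridPoint R n k)..(gridPoint R n (k + 1)), |κ x| := by
        refine (Finset.abs_sum_le_sum_abs _ _).trans (Finset.sum_le_sum fun k hk => ?_)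
        have hk' : k < n + 1 := Finset.mem_range.1 hk
        have hle : gridPoint R n k ≤ gridPoint R n (k + 1) := gridPoint_mono hR n (Nat.le_succ k)
        rw [hdiff n k hk', ← intervalIntegral.integral_const_mul,
          ← intervalIntegral.integral_sub
            ((intervalIntegrable_gridPoint hR hκ hk'.le hk').const_mul _)
            (intervalIntegrable_gridPoint hR hfκ hk'.le hk'),
          ← intervalIntegral.integral_const_mul, ← Real.norm_eq_abs]
        refine intervalIntegral.norm_integral_le_of_norm_le hle (ae_of_all _ fun x hx => ?_)
          ((intervalIntegrable_gridPoint hR hκ.abs hk'.le hk').const_mul _)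
        rw [← sub_mul, norm_mul, Real.norm_eq_abs (κ x)]
        gcongr
        have hA := gridPoint_mem hR hk'.le
        have hB := gridPoint_mem hR (n := n) (k := k + 1) hk'
        have ht := htag n k
        refine (hfδ _ ⟨hA.1.trans ht.1, ht.2.trans hB.2⟩ x
          ⟨hA.1.trans hx.1.le, hx.2.trans hB.2⟩ ?_).le
        rw [Real.dist_eq, abs_lt]
        have := gridPoint_succ_sub R n k
        constructor <;> linarith [ht.1, ht.2, hx.1, hx.2]
    _ = ε / (M + 1) * M := by rw [← Finset.mul_sum, ← hsplit _ hκ.abs]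
    _ < ε := by
        rw [div_mul_eq_mul_div, div_lt_iff₀ (by positivity)]
        nlinarith

/-- If `x` solves `dx = a x dr + dN` and `K` is an integrating factor, then `∑ K ΔN` converges to
`K(R) x(R) - K(0) x(0)`. -/
lemma tendsto_sum_integratingFactor {R : ℝ} (hR : 0 ≤ R) {a K x N : ℝ → ℝ}
    (ha : IntervalIntegrable a volume 0 R) (hK : ContinuousOn K (Set.Icc 0 R))
    (hx : ContinuousOn x (Set.Icc 0 R))
    (hKa : ∀ r ∈ Set.Icc 0 R, ∫ s in (0 : ℝ)..r, -(K s * a s) = K r - K 0)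
    (hN : ∀ r ∈ Set.Icc 0 R, N r = x r - x 0 - ∫ s in (0 : ℝ)..r, x s * a s) :
    Tendsto (fun n => ∑ k ∈ Finset.range (n + 1),
      K (gridPoint R n k) * (N (gridPoint R n (k + 1)) - N (gridPoint R n k))) atTop
      (𝓝 (K R * x R - K 0 * x 0)) := by
  have hu : Set.uIcc 0 R = Set.Icc 0 R := Set.uIcc_of_le hR
  have hmono := gridPoint_mono hR
  -- Discrete summation by parts: `K_k (x_{k+1} - x_k) = Δ(K x)_k - x_{k+1} ΔK_k`. Hence right tags
  -- for `x` here, and left tags for `K` in `h2`.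
  have h1 := tendsto_sum_mul_sub hR (κ := fun s => -(K s * a s)) hx
    (ha.continuousOn_mul (g := K) (by rwa [hu])).neg hKa
    (fun n k => gridPoint R n (k + 1))
    (fun n k => ⟨hmono n (Nat.le_succ k), le_rfl⟩)
  have h2 := tendsto_sum_mul_sub hR (Φ := fun r => ∫ s in (0 : ℝ)..r, x s * a s) hK
    (ha.continuousOn_mul (g := x) (by rwa [hu])) (fun r _ => by simp)
    (fun n k => gridPoint R n k) (fun n k => ⟨le_rfl, hmono n (Nat.le_succ k)⟩)
  have hlim := (tendsto_const_nhds (x := K R * x R - K 0 * x 0)).sub (h1.add h2)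
  -- The integrating factor is chosen so that `x dK + K x a dr = 0`.
  have hzero : (∫ s in (0 : ℝ)..R, x s * -(K s * a s)) +
      ∫ s in (0 : ℝ)..R, K s * (x s * a s) = 0 := by
    have : (fun s => x s * -(K s * a s)) = fun s => -(K s * (x s * a s)) := by
      ext s
      ring
    rw [this, intervalIntegral.integral_neg]
    ring
  rw [hzero, sub_zero] at hlim
  refine hlim.congr fun n => ?_
  have htel := Finset.sum_range_sub (fun k => K (gridPoint R n k) * x (gridPoint R n k)) (n + 1)
  rw [gridPoint_zero, gridPoint_last] at htel
  rw [← htel, ← Finset.sum_add_distrib, ← Finset.sum_sub_distrib]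
  refine Finset.sum_congr rfl fun k hk => ?_
  have hk' : k < n + 1 := Finset.mem_range.1 hk
  rw [hN _ (gridPoint_mem hR hk'), hN _ (gridPoint_mem hR hk'.le)]
  ring

/-! ### Absolutely continuous clocks -/

/-- `L` is continuous and nondecreasing on `[0, R]` with derivative `γ` off a countable set. -/
structure IsClock (L γ : ℝ → ℝ) (R : ℝ) : Prop where
  nonneg : 0 ≤ R
  cont : ContinuousOn L (Set.Icc 0 R)
  hasDerivAt : ∃ S : Set ℝ, S.Countable ∧ ∀ r ∈ Set.Ioo 0 R \ S, HasDerivAt L (γ r) r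
  rate_nonneg : ∀ r ∈ Set.Ioo 0 R, 0 ≤ γ r
  integrable : IntervalIntegrable γ volume 0 R

namespace IsClock

variable {L γ : ℝ → ℝ} {R : ℝ}

lemma intervalIntegrable_mul (h : IsClock L γ R) {ψ : ℝ → ℝ} (hψ : ContinuousOn ψ (Set.Icc 0 R)) :
    IntervalIntegrable (fun s => ψ s * γ s) volume 0 R :=
  h.integrable.continuousOn_mul (by rwa [Set.uIcc_of_le h.nonneg])

/-- The fundamental theorem of calculus with countably many exceptional points, applied to `Ψ ∘ L`.
Every integral in `r` becomes one in `l = log α`, where closed forms exist. -/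
lemma integral_comp (h : IsClock L γ R) {Ψ ψ : ℝ → ℝ}
    (hΨ : ∀ r ∈ Set.Icc 0 R, HasDerivAt Ψ (ψ (L r)) (L r))
    (hψ : ContinuousOn (fun s => ψ (L s)) (Set.Icc 0 R)) {r : ℝ} (hr : r ∈ Set.Icc 0 R) :
    ∫ s in (0 : ℝ)..r, ψ (L s) * γ s = Ψ (L r) - Ψ (L 0) := by
  obtain ⟨S, hS, hd⟩ := h.hasDerivAt
  have hsub : Set.Icc 0 r ⊆ Set.Icc 0 R := Set.Icc_subset_Icc_right hr.2
  refine integral_eq_of_hasDerivAt_off_countable_of_le (fun s => Ψ (L s)) _ hr.1 hS ?_ ?_ ?_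
  · intro s hs
    exact (hΨ s (hsub hs)).continuousAt.comp_continuousWithinAt ((h.cont s (hsub hs)).mono hsub)
  · intro s hs
    have hs' : s ∈ Set.Ioo 0 R := ⟨hs.1.1, hs.1.2.trans_le hr.2⟩
    exact (hΨ s ⟨hs'.1.le, hs'.2.le⟩).comp s (hd s ⟨hs', hs.2⟩)
  · refine (h.intervalIntegrable_mul hψ).mono_set ?_
    rwa [Set.uIcc_of_le h.nonneg, Set.uIcc_of_le hr.1]

lemma integral_rate (h : IsClock L γ R) {r : ℝ} (hr : r ∈ Set.Icc 0 R) :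
    ∫ s in (0 : ℝ)..r, γ s = L r - L 0 := by
  have := h.integral_comp (Ψ := id) (ψ := fun _ => 1) (fun s _ => hasDerivAt_id _)
    continuousOn_const hr
  simpa using this

/-- The noise intensity `lam √γ` is square integrable. -/
lemma memLp_indicator (h : IsClock L γ R) (hγ : Measurable γ) (lam : ℝ) {r : ℝ}
    (hr : r ∈ Set.Icc 0 R) :
    MemLp ((Set.Ioc 0 r).indicator fun s => lam * √(γ s)) 2 volume := by
  have hm : Measurable fun s => lam * √(γ s) := by fun_prop
  rw [memLp_indicator_iff_restrict measurableSet_Ioc, memLp_two_iff_integrable_sq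
    hm.aestronglyMeasurable]
  have hint : IntegrableOn γ (Set.Ioc 0 r) :=
    ((intervalIntegrable_iff_integrableOn_Ioc_of_le h.nonneg).1 h.integrable).mono_set
      (Set.Ioc_subset_Ioc_right hr.2)
  refine ((hint.norm.const_mul (lam ^ 2))).mono' (by fun_prop) (ae_of_all _ fun s => ?_)
  rw [Real.norm_of_nonneg (sq_nonneg _), mul_pow, Real.norm_eq_abs]
  gcongr
  rcases le_total 0 (γ s) with h0 | h0
  · rw [Real.sq_sqrt h0]
    exact le_abs_self _
  · rw [Real.sqrt_eq_zero_of_nonpos h0]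
    simp

end IsClock

lemma sq_sum_eq_sum_sq {ι : Type*} (s : Finset ι) (f : ι → ℝ)
    (h : ∀ i ∈ s, ∀ j ∈ s, i ≠ j → f i * f j = 0) : (∑ i ∈ s, f i) ^ 2 = ∑ i ∈ s, f i ^ 2 := by
  rw [sq, Finset.sum_mul_sum]
  refine Finset.sum_congr rfl fun i hi => ?_
  rw [Finset.sum_eq_single_of_mem i hi fun j hj hji => h i hi j hj hji.symm, sq]

/-- The squared `L²` norm of the integrand of `∑ w ΔN`. -/
lemma IsClock.integral_sq_sum {L γ : ℝ → ℝ} {R : ℝ} (h : IsClock L γ R)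
    (lam : ℝ) (w : ℕ → ℝ) (n : ℕ) :
    ∫ x, (∑ k ∈ Finset.range (n + 1), w k •
      ((Set.Ioc 0 (gridPoint R n (k + 1))).indicator (fun s => lam * √(γ s)) -
        (Set.Ioc 0 (gridPoint R n k)).indicator (fun s => lam * √(γ s)))) x ^ 2 =
      ∑ k ∈ Finset.range (n + 1), w k ^ 2 *
        (lam ^ 2 * L (gridPoint R n (k + 1)) - lam ^ 2 * L (gridPoint R n k)) := by
  set A : ℕ → Set ℝ := fun k => Set.Ioc (gridPoint R n k) (gridPoint R n (k + 1)) with hA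
  have hmono := gridPoint_mono h.nonneg n
  have hpos : ∀ k, 0 ≤ gridPoint R n k := fun k =>
    (gridPoint_zero R n).symm.le.trans (hmono (Nat.zero_le k))
  have hdisj : ∀ x, ∀ i j, i ≠ j → x ∈ A i → x ∉ A j := fun x i j hij hi hj =>
    Set.disjoint_left.1 (hmono.pairwise_disjoint_on_Ioc_succ hij) hi hj
  have hpt : ∀ x, (∑ k ∈ Finset.range (n + 1), w k •
      ((Set.Ioc 0 (gridPoint R n (k + 1))).indicator (fun s => lam * √(γ s)) -
        (Set.Ioc 0 (gridPoint R n k)).indicator (fun s => lam * √(γ s)))) x ^ 2 =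
      ∑ k ∈ Finset.range (n + 1), w k ^ 2 *
        (A k).indicator (fun s => (lam * √(γ s)) ^ 2) x := by
    intro x
    have hk : ∀ k, (Set.Ioc 0 (gridPoint R n (k + 1))).indicator (fun s => lam * √(γ s)) x -
        (Set.Ioc 0 (gridPoint R n k)).indicator (fun s => lam * √(γ s)) x =
        (A k).indicator (fun s => lam * √(γ s)) x := by
      intro k
      have := hmono (Nat.le_succ k)
      have := hpos k
      simp only [hA, Set.indicator_apply, Set.mem_Ioc]
      grind
    simp only [Finset.sum_apply, Pi.smul_apply, Pi.sub_apply, hk, smul_eq_mul]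
    rw [sq_sum_eq_sum_sq]
    · refine Finset.sum_congr rfl fun k _ => ?_
      by_cases hx : x ∈ A k <;> simp [hx, mul_pow]
    · intro i _ j _ hij
      by_cases hx : x ∈ A i
      · simp [hdisj x i j hij hx]
      · simp [hx]
  simp_rw [hpt]
  have hIoc : ∀ k < n + 1, IntegrableOn γ (A k) := fun k hk =>
    (intervalIntegrable_iff_integrableOn_Ioc_of_le (hmono (Nat.le_succ k))).1
      (intervalIntegrable_gridPoint h.nonneg h.integrable hk.le hk)
  have hae : ∀ k < n + 1, ∀ᵐ x ∂volume.restrict (A k), (lam * √(γ x)) ^ 2 = lam ^ 2 * γ x := by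
    intro k hk
    rw [ae_restrict_iff' measurableSet_Ioc]
    -- The sign of `γ`, needed for `√γ ^ 2 = γ`, is known only inside the interval, so the endpoint
    -- `R` is dropped as a null set.
    have hne : ∀ᵐ x : ℝ, x ≠ R := by simp [ae_iff, measure_singleton]
    filter_upwards [hne] with x hx hxA
    have hxR : x ≤ R := hxA.2.trans (gridPoint_mem h.nonneg hk).2
    rw [mul_pow, Real.sq_sqrt (h.rate_nonneg x ⟨(hpos k).trans_lt hxA.1, lt_of_le_of_ne hxR hx⟩)]
  have hint : ∀ k < n + 1, IntegrableOn (fun x => (lam * √(γ x)) ^ 2) (A k) := fun k hk =>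
    ((hIoc k hk).const_mul (lam ^ 2)).congr ((hae k hk).mono fun x hx => hx.symm)
  rw [integral_finsetSum _ fun k hk =>
    ((integrable_indicator_iff measurableSet_Ioc).2 (hint k (Finset.mem_range.1 hk))).const_mul _]
  refine Finset.sum_congr rfl fun k hk => ?_
  have hk' : k < n + 1 := Finset.mem_range.1 hk
  rw [integral_const_mul, integral_indicator measurableSet_Ioc, integral_congr_ae (hae k hk'),
    integral_const_mul, ← intervalIntegral.integral_of_le (hmono (Nat.le_succ k)), ← mul_sub]
  have h0 : (0 : ℝ) = gridPoint R n 0 := (gridPoint_zero R n).symm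
  rw [← intervalIntegral.integral_interval_sub_left (a := 0)
    (h0 ▸ intervalIntegrable_gridPoint h.nonneg h.integrable (Nat.zero_le _) hk')
    (h0 ▸ intervalIntegrable_gridPoint h.nonneg h.integrable (Nat.zero_le _) hk'.le),
    h.integral_rate (gridPoint_mem h.nonneg hk'), h.integral_rate (gridPoint_mem h.nonneg hk'.le)]
  ring

/-- The joint characteristic function of a linear equation `dx = a x dr + lam √γ dW` with
integrating factor `K`. -/
lemma integral_cexp_linear {Ω : Type*} [MeasurableSpace Ω] {P : Measure Ω} [IsProbabilityMeasure P]
    {d : ℕ} {W : ℝ≥0 → Ω → State d} (hW : IsStandardBrownian W P) {Y : Ω → ℝ}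
    (hYm : AEMeasurable Y P) (hY : IndepFun Y (fun ω (r : ℝ≥0) => W r ω) P)
    {L γ : ℝ → ℝ} {R : ℝ} (h : IsClock L γ R) (lam : ℝ)
    {a K : ℝ → ℝ} (ha : IntervalIntegrable a volume 0 R) (hK : ContinuousOn K (Set.Icc 0 R))
    (hKa : ∀ r ∈ Set.Icc 0 R, ∫ s in (0 : ℝ)..r, -(K s * a s) = K r - K 0)
    {x N : Fin d → ℝ → Ω → ℝ}
    (hx : ∀ᵐ ω ∂P, ∀ i, ContinuousOn (fun r => x i r ω) (Set.Icc 0 R))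
    (hxN : ∀ᵐ ω ∂P, ∀ i, ∀ r ∈ Set.Icc 0 R,
      N i r ω = x i r ω - x i 0 ω - ∫ s in (0 : ℝ)..r, x i s ω * a s)
    (hN : ∀ i, ∀ r ∈ Set.Icc 0 R, IsIsonormalValue P (fun r ω => W r ω i)
      ((Set.Ioc 0 r).indicator fun s => lam * √(γ s)) (N i r)) (η : Fin d → ℝ) :
    ∫ ω, Complex.exp ((Y ω + ∑ i, η i * (K R * x i R ω - K 0 * x i 0 ω) : ℝ) * Complex.I) ∂P =
      (∫ ω, Complex.exp (Y ω * Complex.I) ∂P) * Complex.exp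
        (-(((∑ i, η i ^ 2) * (∫ s in (0 : ℝ)..R, K s ^ 2 * (lam ^ 2 * γ s)) / 2 : ℝ) : ℂ)) := by
  have hB : ∀ i, IsPreBrownianReal (fun r ω => W r ω i) P :=
    fun i => (hW.coord i).toIsPreBrownianReal
  set F : ℕ → ℝ → ℝ := fun n => ∑ k ∈ Finset.range (n + 1), K (gridPoint R n k) •
    ((Set.Ioc 0 (gridPoint R n (k + 1))).indicator (fun s => lam * √(γ s)) -
      (Set.Ioc 0 (gridPoint R n k)).indicator (fun s => lam * √(γ s))) with hF
  set Z : ℕ → Fin d → Ω → ℝ := fun n i => ∑ k ∈ Finset.range (n + 1), K (gridPoint R n k) •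
    (N i (gridPoint R n (k + 1)) - N i (gridPoint R n k)) with hZ
  have hiso : ∀ n i, IsIsonormalValue P (fun r ω => W r ω i) (η i • F n) (η i • Z n i) :=
    fun n i => (IsIsonormalValue.sum (hB i) _ fun k hk =>
      (((hN i _ (gridPoint_mem h.nonneg (Finset.mem_range.1 hk))).sub (hB i)
        (hN i _ (gridPoint_mem h.nonneg (Finset.mem_range.1 hk).le))).smul _)).smul _
  have hchar := fun n => integral_cexp_add_sum_isonormal hW hYm hY (hiso n)
  have hlhs : Tendsto (fun n => ∫ ω, Complex.exp ((Y ω + ∑ i, (η i • Z n i) ω : ℝ) *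
      Complex.I) ∂P) atTop (𝓝 (∫ ω, Complex.exp
        ((Y ω + ∑ i, η i * (K R * x i R ω - K 0 * x i 0 ω) : ℝ) * Complex.I) ∂P)) := by
    -- The sums converge almost surely, by the integrating factor identity on each path; their laws
    -- are computed separately in `hvar` and `hrhs`.
    refine tendsto_integral_cexp_of_ae (fun n => hYm.add
      (Finset.aemeasurable_fun_sum _ fun i _ => (hiso n i).memLp_val.aemeasurable)) ?_
    filter_upwards [hx, hxN] with ω hω hω'
    refine Tendsto.const_add _ (tendsto_finsetSum _ fun i _ => ?_)
    have := (tendsto_sum_integratingFactor h.nonneg ha hK (hω i) hKa (hω' i)).const_mul (η i)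
    refine this.congr fun n => ?_
    simp [hZ]
  have hvar : ∀ n, ∑ i, ∫ s, (η i • F n) s ^ 2 = (∑ i, η i ^ 2) *
      ∑ k ∈ Finset.range (n + 1), K (gridPoint R n k) ^ 2 *
        (lam ^ 2 * L (gridPoint R n (k + 1)) - lam ^ 2 * L (gridPoint R n k)) := by
    intro n
    rw [Finset.sum_mul]
    refine Finset.sum_congr rfl fun i _ => ?_
    rw [← h.integral_sq_sum lam (fun k => K (gridPoint R n k)) n, ← integral_const_mul]
    simp only [Pi.smul_apply, smul_eq_mul, mul_pow, hF]
  have hsum := tendsto_sum_mul_sub h.nonneg (f := fun s => K s ^ 2) (Φ := fun r => lam ^ 2 * L r)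
    (hK.pow 2) (h.integrable.const_mul (lam ^ 2))
    (fun r hr => by rw [intervalIntegral.integral_const_mul, h.integral_rate hr]; ring)
    (fun n k => gridPoint R n k) (fun n k => ⟨le_rfl, gridPoint_mono h.nonneg n (Nat.le_succ k)⟩)
  have hrhs : Tendsto (fun n => (∫ ω, Complex.exp (Y ω * Complex.I) ∂P) *
      Complex.exp (-(((∑ i, ∫ s, (η i • F n) s ^ 2) / 2 : ℝ) : ℂ))) atTop
      (𝓝 ((∫ ω, Complex.exp (Y ω * Complex.I) ∂P) * Complex.exp
        (-(((∑ i, η i ^ 2) * (∫ s in (0 : ℝ)..R, K s ^ 2 * (lam ^ 2 * γ s)) / 2 : ℝ) : ℂ)))) := by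
    refine Tendsto.const_mul _ ?_
    simp_rw [hvar]
    have hcont : Continuous fun v : ℝ => Complex.exp (-((v / 2 : ℝ) : ℂ)) := by fun_prop
    exact (hcont.tendsto _).comp (hsum.const_mul _)
  exact tendsto_nhds_unique hlhs (by simpa only [hchar] using hrhs)

/-! ### The schedule seen from `t` backward in time -/

section Schedule

variable {α : ℝ → ℝ} {T t Δ : ℝ}

lemma IsDDPMSchedule.pos_of_le (hα : IsDDPMSchedule α T) (hend : t ≤ T) (hαt : 0 < α t) {τ : ℝ}
    (h0 : 0 ≤ τ) (hτ : τ ≤ t) : 0 < α τ :=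
  hαt.trans_le (hα.antitone ⟨h0, hτ.trans hend⟩ ⟨h0.trans hτ, hend⟩ hτ)

/-- Monotonicity of `r ↦ log α (t - r)` gives both the sign of the rate and its integrability; no
separate absolute continuity assumption is needed. -/
lemma IsDDPMSchedule.isClock (hα : IsDDPMSchedule α T) (hstart : 0 ≤ t - Δ) (hend : t ≤ T)
    (hαt : 0 < α t) {R : ℝ} (hR0 : 0 ≤ R) (hR : R ≤ Δ) :
    IsClock (fun r => Real.log (α (t - r))) (fun r => -deriv (fun q => Real.log (α q)) (t - r))
      R := by
  have hmem : ∀ r ∈ Set.Icc 0 R, t - r ∈ Set.Icc 0 T := fun r hr =>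
    ⟨by linarith [hr.2], by linarith [hr.1]⟩
  have hpos : ∀ r ∈ Set.Icc 0 R, 0 < α (t - r) := fun r hr =>
    hα.pos_of_le hend hαt (hmem r hr).1 (by linarith [hr.1])
  have hmono : MonotoneOn (fun r => Real.log (α (t - r))) (Set.Icc 0 R) := by
    intro r hr s hs hrs
    exact Real.log_le_log (hpos r hr) (hα.antitone (hmem s hs) (hmem r hr) (by linarith))
  have hderiv : deriv (fun r => Real.log (α (t - r))) =
      fun r => -deriv (fun q => Real.log (α q)) (t - r) :=
    funext fun r => deriv_comp_const_sub (f := fun q => Real.log (α q)) (a := t) (x := r)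
  refine ⟨hR0, ?_, ?_, ?_, ?_⟩
  · refine ContinuousOn.log ?_ fun r hr => (hpos r hr).ne'
    exact hα.continuous.comp (by fun_prop) hmem
  · obtain ⟨S, hS, hd⟩ := hα.differentiable
    refine ⟨(fun r => t - r) ⁻¹' S, hS.preimage (fun a b hab => by simpa using hab),
      fun r hr => ?_⟩
    have hr' : t - r ∈ Set.Ioo 0 T \ S :=
      ⟨⟨by linarith [hr.1.2], by linarith [hr.1.1]⟩, hr.2⟩
    rw [← congrFun hderiv r]
    refine DifferentiableAt.hasDerivAt ?_
    refine DifferentiableAt.log ?_ (hpos r ⟨hr.1.1.le, hr.1.2.le⟩).ne'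
    exact DifferentiableAt.comp r (hd _ hr') (by fun_prop)
  · intro r hr
    have h := hmono.derivWithin_nonneg (x := r)
    rw [derivWithin_of_mem_nhds (Icc_mem_nhds hr.1 hr.2), hderiv] at h
    exact h
  · rw [← hderiv]
    exact MonotoneOn.intervalIntegrable_deriv (by rwa [Set.uIcc_of_le hR0])

end Schedule

/-! ### Closed form of the integrating factor -/

/-- The logarithm of the fundamental solution, as a function of `log α`. -/
noncomputable def logFundamental (lam l₀ l : ℝ) : ℝ :=
  (1 + lam ^ 2) / 2 * (Real.log (1 - Real.exp l) - Real.log (1 - Real.exp l₀)) -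
    lam ^ 2 / 2 * (l - l₀)

/-- The derivative of `logFundamental`. -/
noncomputable def rateFundamental (lam l : ℝ) : ℝ :=
  -((Real.exp l + lam ^ 2) / (2 * (1 - Real.exp l)))

lemma logFundamental_self (lam l : ℝ) : logFundamental lam l l = 0 := by
  simp [logFundamental]

lemma hasDerivAt_log_one_sub_exp {l : ℝ} (hl : Real.exp l < 1) :
    HasDerivAt (fun l => Real.log (1 - Real.exp l)) (-Real.exp l / (1 - Real.exp l)) l :=
  ((Real.hasDerivAt_exp l).const_sub 1).log (by linarith)

lemma hasDerivAt_logFundamental (lam l₀ : ℝ) {l : ℝ} (hl : Real.exp l < 1) :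
    HasDerivAt (logFundamental lam l₀) (rateFundamental lam l) l := by
  have h := (((hasDerivAt_log_one_sub_exp hl).sub_const (Real.log (1 - Real.exp l₀))).const_mul
    ((1 + lam ^ 2) / 2)).sub (((hasDerivAt_id l).sub_const l₀).const_mul (lam ^ 2 / 2))
  have h1 : 1 - Real.exp l ≠ 0 := by linarith
  refine h.congr_deriv ?_
  rw [rateFundamental]
  field_simp
  ring

/-- An antiderivative of `lam² exp (-2 logFundamental)`. -/
noncomputable def varianceFundamental (lam l₀ l : ℝ) : ℝ :=
  (1 - Real.exp l₀) * Real.exp (-(lam ^ 2 *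
    (Real.log (1 - Real.exp l) - Real.log (1 - Real.exp l₀) - (l - l₀))))

lemma hasDerivAt_varianceFundamental (lam : ℝ) {l₀ l : ℝ} (hl₀ : Real.exp l₀ < 1)
    (hl : Real.exp l < 1) :
    HasDerivAt (varianceFundamental lam l₀)
      (lam ^ 2 * Real.exp (-logFundamental lam l₀ l) ^ 2) l := by
  have h := ((((((hasDerivAt_log_one_sub_exp hl).sub_const
    (Real.log (1 - Real.exp l₀))).sub ((hasDerivAt_id l).sub_const l₀)).const_mul
      (lam ^ 2)).neg).exp).const_mul (1 - Real.exp l₀)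
  have h1 : 0 < 1 - Real.exp l := by linarith
  have h2 : 0 < 1 - Real.exp l₀ := by linarith
  refine h.congr_deriv ?_
  -- Squaring `exp (-θ)` splits off the factor `(1 - e^{l₀})/(1 - e^l)`; what remains is the
  -- exponential in `varianceFundamental`, whose exponent has derivative `-lam² (-e^l/(1 - e^l) - 1)
  -- = lam²/(1 - e^l)`.
  have key : Real.exp (-logFundamental lam l₀ l) ^ 2 = (1 - Real.exp l₀) / (1 - Real.exp l) *
      Real.exp (-(lam ^ 2 *
        (Real.log (1 - Real.exp l) - Real.log (1 - Real.exp l₀) - (l - l₀)))) := by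
    have hdiv : (1 - Real.exp l₀) / (1 - Real.exp l) =
        Real.exp (Real.log (1 - Real.exp l₀) - Real.log (1 - Real.exp l)) := by
      rw [Real.exp_sub, Real.exp_log h2, Real.exp_log h1]
    rw [← Real.exp_nat_mul, hdiv, ← Real.exp_add, logFundamental]
    congr 1
    push_cast
    ring
  rw [key]
  simp only [Pi.neg_apply, Pi.sub_apply, id]
  field_simp
  ring

/-- In exponential form, the identities for the mean and the variance reduce to linear identities
between logarithms. -/
lemma one_sub_sub_stepVar (α : ℝ → ℝ) (lam : ℝ) {t t' : ℝ} (h0 : 0 < α t)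
    (h1 : α t < 1) (h0' : 0 < α t') (h1' : α t' < 1) :
    1 - α t' - stepVar α lam t t' = Real.exp (Real.log (1 - α t') + lam ^ 2 *
      (Real.log (1 - α t') - Real.log (1 - α t) - (Real.log (α t') - Real.log (α t)))) := by
  have hp : 0 < 1 - α t := by linarith
  have hq : 0 < 1 - α t' := by linarith
  rw [stepVar, Real.rpow_def_of_pos (by positivity), Real.rpow_def_of_pos (by positivity),
    Real.log_div hq.ne' hp.ne', Real.log_div h0.ne' h0'.ne', ← Real.exp_add,
    Real.exp_add (Real.log (1 - α t')), Real.exp_log hq]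
  ring_nf

lemma sq_exp_logFundamental_mul_variance (α : ℝ → ℝ) (lam : ℝ) {t t' : ℝ} (h0 : 0 < α t)
    (h1 : α t < 1) (h0' : 0 < α t') (h1' : α t' < 1) :
    Real.exp (logFundamental lam (Real.log (α t)) (Real.log (α t'))) ^ 2 *
      (varianceFundamental lam (Real.log (α t)) (Real.log (α t')) -
        varianceFundamental lam (Real.log (α t)) (Real.log (α t))) = stepVar α lam t t' := by
  have hp : 0 < 1 - α t := by linarith
  have hq : 0 < 1 - α t' := by linarith
  have h := one_sub_sub_stepVar α lam h0 h1 h0' h1'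
  have h' : stepVar α lam t t' = Real.exp (Real.log (1 - α t')) - Real.exp (Real.log (1 - α t') +
      lam ^ 2 * (Real.log (1 - α t') - Real.log (1 - α t) -
        (Real.log (α t') - Real.log (α t)))) := by
    rw [← h, Real.exp_log hq]
    ring
  rw [h', logFundamental, varianceFundamental, varianceFundamental, Real.exp_log h0,
    Real.exp_log h0', ← Real.exp_nat_mul, mul_sub, ← mul_assoc, ← mul_assoc]
  -- Only the two prefactors `1 - α t` become exponentials; the copies inside logarithms stay.
  nth_rewrite 2 [← Real.exp_log hp]
  nth_rewrite 5 [← Real.exp_log hp]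
  rw [← Real.exp_add, ← Real.exp_add, ← Real.exp_add]
  congr 2 <;> push_cast <;> ring

lemma exp_logFundamental_mul_sqrt (α : ℝ → ℝ) (lam : ℝ) {t t' : ℝ} (h0 : 0 < α t)
    (h1 : α t < 1) (h0' : 0 < α t') (h1' : α t' < 1) :
    Real.exp (logFundamental lam (Real.log (α t)) (Real.log (α t'))) * √(1 - α t) =
      √(1 - α t' - stepVar α lam t t') := by
  have hp : 0 < 1 - α t := by linarith
  rw [one_sub_sub_stepVar α lam h0 h1 h0' h1', ← Real.exp_half, logFundamental, Real.exp_log h0,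
    Real.exp_log h0']
  have hs : √(1 - α t) = Real.exp (Real.log (1 - α t) / 2) := by
    rw [Real.exp_half, Real.exp_log hp]
  rw [hs, ← Real.exp_add]
  congr 1
  ring

/-- The combined base of the powers is at most `1`, since `(1 - α t') α t ≤ (1 - α t) α t'` amounts
to `α t ≤ α t'`. The case `α t' = 1` is included. -/
lemma stepVar_nonneg (α : ℝ → ℝ) (lam : ℝ) {t t' : ℝ} (h0 : 0 < α t) (h1 : α t < 1)
    (hle : α t ≤ α t') (h1' : α t' ≤ 1) : 0 ≤ stepVar α lam t t' := by
  have hq : 0 < α t' := h0.trans_le hle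
  have hp : 0 < 1 - α t := by linarith
  rw [stepVar, ← Real.mul_rpow (div_nonneg (by linarith) hp.le) (div_nonneg h0.le hq.le)]
  refine mul_nonneg (by linarith) (sub_nonneg.2 (Real.rpow_le_one ?_ ?_ (sq_nonneg _)))
  · exact mul_nonneg (div_nonneg (by linarith) hp.le) (div_nonneg h0.le hq.le)
  · rw [div_mul_div_comm, div_le_one (by positivity)]
    nlinarith

lemma stepVar_le (α : ℝ → ℝ) (lam : ℝ) {t t' : ℝ} (h0 : 0 < α t) (h1 : α t < 1)
    (hle : α t ≤ α t') (h1' : α t' ≤ 1) : 0 ≤ 1 - α t' - stepVar α lam t t' := by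
  have hq : 0 < α t' := h0.trans_le hle
  have hp : 0 < 1 - α t := by linarith
  have hq1 : 0 ≤ 1 - α t' := by linarith
  have : 1 - α t' - stepVar α lam t t' = (1 - α t') *
      (((1 - α t') / (1 - α t)) ^ (lam ^ 2) * (α t / α t') ^ (lam ^ 2)) := by
    rw [stepVar]
    ring
  rw [this]
  positivity

/-! ### The solution of the denoising equation -/

lemma lambdaDrift_apply {d : ℕ} (α : ℝ → ℝ) (lam : ℝ) (s : State d → ℝ → State d) (x : State d)
    {τ : ℝ} (hτ : 0 ≤ -deriv (fun q => Real.log (α q)) τ) (i : Fin d) :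
    lambdaDrift (ddpmF d α) (ddpmG d α) lam s x τ i =
      -(-deriv (fun q => Real.log (α q)) τ / 2 * x i) -
        (1 + lam ^ 2) / 2 * (-deriv (fun q => Real.log (α q)) τ * s x τ i) := by
  simp only [lambdaDrift, ddpmF, ddpmG, Matrix.transpose_smul, Matrix.transpose_one,
    Matrix.mul_smul, Matrix.mul_one, smul_smul, Real.mul_self_sqrt hτ, map_smul,
    map_one, PiLp.sub_apply, PiLp.smul_apply, smul_eq_mul, _root_.smul_apply,
    one_apply_eq_self]
  ring

/-- The `u(t)` and `ε_θ` terms merge into one multiple of `y - √(1 - α t) ε`, so the score is linear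
in the deviation. -/
lemma approxScore_apply {d : ℕ} (α : ℝ → ℝ) (eps : State d → ℝ → State d) {t : ℝ} (ht : α t < 1)
    (y x : State d) (τ : ℝ) (i : Fin d) :
    approxScore α eps t y x τ i =
      -((x i - √(α τ / α t) * (y i - √(1 - α t) * eps y t i)) / (1 - α τ)) := by
  have h : √(1 - α t) ≠ 0 := (Real.sqrt_pos.2 (by linarith)).ne'
  have h2 : (1 - α t) / √(1 - α t) = √(1 - α t) := Real.div_sqrt
  simp only [approxScore, score, PiLp.sub_apply, PiLp.smul_apply, PiLp.neg_apply, smul_eq_mul]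
  rw [show (1 - α t) / (1 - α τ) * √(α τ / α t) * -(1 / √(1 - α t) * eps y t i) =
    -((1 - α t) / √(1 - α t) * (√(α τ / α t) * eps y t i / (1 - α τ))) by ring, h2]
  ring

lemma continuousOn_rateFundamental_comp (lam : ℝ) {L : ℝ → ℝ} {s : Set ℝ} (hL : ContinuousOn L s)
    (h : ∀ r ∈ s, Real.exp (L r) < 1) : ContinuousOn (fun r => rateFundamental lam (L r)) s := by
  refine ((hL.rexp.add continuousOn_const).div
    (continuousOn_const.mul (continuousOn_const.sub hL.rexp)) fun r hr => ?_).neg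
  have := h r hr
  exact mul_ne_zero two_ne_zero (sub_ne_zero.2 this.ne')

section Solution

variable {Ω : Type*} [MeasurableSpace Ω] {P : Measure Ω} {d : ℕ} {T : ℝ} {α : ℝ → ℝ} {lam t Δ : ℝ}
  {eps : State d → ℝ → State d} {W : ℝ≥0 → Ω → State d} {u : ℝ → Ω → State d}

/-- The noise part `∫ lam G dW` of a solution. -/
noncomputable def noisePart (α : ℝ → ℝ) (lam t : ℝ) (eps : State d → ℝ → State d)
    (u : ℝ → Ω → State d) (i : Fin d) (r : ℝ) (ω : Ω) : ℝ :=
  u (t - r) ω i - u t ω i - (∫ q in t..(t - r),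
    lambdaDrift (ddpmF d α) (ddpmG d α) lam (approxScore α eps t (u t ω)) (u q ω) q) i

/-- The deviation of a solution from the particular solution through `y = u_t - √(1 - α_t) ε`. -/
noncomputable def deviation (α : ℝ → ℝ) (t : ℝ) (eps : State d → ℝ → State d)
    (u : ℝ → Ω → State d) (i : Fin d) (r : ℝ) (ω : Ω) : ℝ :=
  u (t - r) ω i - √(α (t - r) / α t) * (u t ω i - √(1 - α t) * eps (u t ω) t i)

/-- Since `G` is scalar, coordinate `i` is driven by `W^i` alone; this keeps the noises of different
coordinates independent. -/
lemma isIsonormalValue_noisePart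
    (hu : IsLambdaSDESolution P (ddpmF d α) (ddpmG d α) lam
      (fun ω => approxScore α eps t (u t ω)) t Δ W u)
    {R : ℝ} (hR : R ≤ Δ)
    (hclock : IsClock (fun r => Real.log (α (t - r)))
      (fun r => -deriv (fun q => Real.log (α q)) (t - r)) R)
    (i : Fin d) {r : ℝ} (hr : r ∈ Set.Icc 0 R) :
    IsIsonormalValue P (fun r ω => W r ω i) ((Set.Ioc 0 r).indicator
      fun s => lam * √(-deriv (fun q => Real.log (α q)) (t - s)))
      (noisePart α lam t eps u i r) := by
  obtain ⟨I, ⟨J, hJ, hI⟩, heq⟩ := hu.equation (t - r) ⟨by linarith [hr.2], by linarith [hr.1]⟩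
  have hcoe : (((t - (t - r)).toNNReal : ℝ≥0) : ℝ) = r := by
    rw [sub_sub_cancel, Real.coe_toNNReal _ hr.1]
  have hγ : Measurable fun r => -deriv (fun q => Real.log (α q)) (t - r) :=
    ((measurable_deriv _).comp (by fun_prop)).neg
  have hoff : ∀ j, j ≠ i → J i j =ᵐ[P] 0 := by
    intro j hj
    have h := hJ i j
    have hfun : (fun r => (lam • ddpmG d α (t - r)) i j) = 0 := by
      ext s
      simp [ddpmG, Matrix.one_apply_ne hj.symm]
    rw [hfun] at h
    have h' := h.isIsonormalValue (by simp)
    rw [Set.indicator_zero'] at h'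
    exact h'.ae_eq_zero (hu.brownian.coord j).toIsPreBrownianReal
  have hdiag := hJ i i
  have hfun : (fun r => (lam • ddpmG d α (t - r)) i i) =
      fun s => lam * √(-deriv (fun q => Real.log (α q)) (t - s)) := by
    ext s
    simp [ddpmG]
  rw [hfun] at hdiag
  have hiso := hdiag.isIsonormalValue (by rw [hcoe]; exact hclock.memLp_indicator hγ lam hr)
  rw [hcoe] at hiso
  refine hiso.congr_ae ?_
  have hoff' : ∀ᵐ ω ∂P, ∀ j, j ≠ i → J i j ω = 0 := by
    rw [ae_all_iff]
    intro j
    by_cases hj : j = i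
    · simp [hj]
    · filter_upwards [hoff j hj] with ω hω _ using hω
  filter_upwards [hoff', hI i, heq] with ω h1 h2 h3
  rw [noisePart, h3]
  simp only [PiLp.add_apply]
  rw [h2, Finset.sum_eq_single_of_mem i (Finset.mem_univ i) fun j _ hj => h1 j hj]
  ring

/-- Subtracting the particular solution removes the inhomogeneous drift. The requirement `R < Δ`
keeps `1 - α` away from `0`, so the rate is continuous up to `R`. -/
lemma noisePart_eq {Ω : Type*} {u : ℝ → Ω → State d} (hα : IsDDPMSchedule α T) (hend : t ≤ T)
    (hstart : 0 ≤ t - Δ) (hαt : 0 < α t) (hα1 : ∀ τ ∈ Set.Ioc (t - Δ) t, α τ < 1)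
    {R : ℝ} (hR0 : 0 ≤ R) (hR : R < Δ) {ω : Ω}
    (hcont : ContinuousOn (fun τ => u τ ω) (Set.Icc (t - Δ) t))
    (hint : IntervalIntegrable (fun q => lambdaDrift (ddpmF d α) (ddpmG d α) lam
      (approxScore α eps t (u t ω)) (u q ω) q) volume (t - Δ) t) (i : Fin d) :
    ContinuousOn (fun r => deviation α t eps u i r ω) (Set.Icc 0 R) ∧
    ∀ r ∈ Set.Icc 0 R, noisePart α lam t eps u i r ω =
      deviation α t eps u i r ω - deviation α t eps u i 0 ω -
        ∫ s in (0 : ℝ)..r, deviation α t eps u i s ω *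
          (rateFundamental lam (Real.log (α (t - s))) *
            -deriv (fun q => Real.log (α q)) (t - s)) := by
  have hclock := hα.isClock hstart hend hαt hR0 hR.le
  have hpos : ∀ r ∈ Set.Icc 0 R, 0 < α (t - r) := fun r hr =>
    hα.pos_of_le hend hαt (by linarith [hr.2]) (by linarith [hr.1])
  have hlt : ∀ r ∈ Set.Icc 0 R, α (t - r) < 1 := fun r hr =>
    hα1 _ ⟨by linarith [hr.2], by linarith [hr.1]⟩
  have hαc : ContinuousOn (fun r => α (t - r)) (Set.Icc 0 R) :=
    hα.continuous.comp (by fun_prop) fun r hr => ⟨by linarith [hr.2], by linarith [hr.1]⟩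
  have hut : ContinuousOn (fun r => u (t - r) ω i) (Set.Icc 0 R) := by
    have h1 : ContinuousOn (fun r => u (t - r) ω) (Set.Icc 0 R) :=
      hcont.comp (f := fun r => t - r) (by fun_prop)
        fun r hr => ⟨by linarith [hr.2], by linarith [hr.1]⟩
    exact (EuclideanSpace.proj (𝕜 := ℝ) i).continuous.comp_continuousOn h1
  have hdev : ContinuousOn (fun r => deviation α t eps u i r ω) (Set.Icc 0 R) :=
    hut.sub ((hαc.div_const _).sqrt.mul continuousOn_const)
  have hrate := continuousOn_rateFundamental_comp lam hclock.cont fun s hs => by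
    rw [Real.exp_log (hpos s hs)]
    exact hlt s hs
  refine ⟨hdev, fun r hr => ?_⟩
  have hsub : Set.Icc 0 r ⊆ Set.Icc 0 R := Set.Icc_subset_Icc_right hr.2
  have huIcc : Set.uIcc 0 r ⊆ Set.uIcc 0 R := by
    rwa [Set.uIcc_of_le hr.1, Set.uIcc_of_le hR0]
  set y : ℝ := u t ω i - √(1 - α t) * eps (u t ω) t i with hy
  set γ : ℝ → ℝ := fun s => -deriv (fun q => Real.log (α q)) (t - s) with hγ
  have hsqrt : ∀ s ∈ Set.Icc 0 R, √(α (t - s) / α t) =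
      Real.exp ((Real.log (α (t - s)) - Real.log (α t)) / 2) := by
    intro s hs
    rw [Real.exp_half, Real.exp_sub, Real.exp_log (hpos s hs), Real.exp_log hαt]
  -- the particular solution
  have hpart : ∫ s in (0 : ℝ)..r, √(α (t - s) / α t) / 2 * γ s =
      √(α (t - r) / α t) - √(α (t - 0) / α t) := by
    have h := hclock.integral_comp (Ψ := fun l => Real.exp ((l - Real.log (α t)) / 2))
      (ψ := fun l => Real.exp ((l - Real.log (α t)) / 2) / 2)
      (fun s _ => by
        have := ((((hasDerivAt_id (Real.log (α (t - s)))).sub_const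
          (Real.log (α t))).div_const 2).exp)
        refine this.congr_deriv ?_
        simp only [id]
        ring)
      (((hclock.cont.sub continuousOn_const).div_const 2).rexp.div_const 2) hr
    rw [hsqrt r hr, hsqrt 0 ⟨le_rfl, hR0⟩, ← h]
    refine intervalIntegral.integral_congr fun s hs => ?_
    rw [Set.uIcc_of_le hr.1] at hs
    simp only [hsqrt s (hsub hs)]
  have hint1 : IntervalIntegrable (fun s => √(α (t - s) / α t) / 2 * γ s) volume 0 r :=
    (hclock.intervalIntegrable_mul ((hαc.div_const _).sqrt.div_const 2)).mono_set huIcc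
  have hint2 : IntervalIntegrable (fun s => deviation α t eps u i s ω *
      (rateFundamental lam (Real.log (α (t - s))) * γ s)) volume 0 r := by
    refine ((hclock.intervalIntegrable_mul (hdev.mul hrate)).mono_set huIcc).congr
      fun s _ => ?_
    simp only [Pi.mul_apply]
    ring
  -- the drift
  have hdrift : (∫ q in t..(t - r), lambdaDrift (ddpmF d α) (ddpmG d α) lam
      (approxScore α eps t (u t ω)) (u q ω) q) i =
      ∫ s in (0 : ℝ)..r, (√(α (t - s) / α t) / 2 * γ s * y + deviation α t eps u i s ω *
        (rateFundamental lam (Real.log (α (t - s))) * γ s)) := by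
    have hint' : IntervalIntegrable (fun q => lambdaDrift (ddpmF d α) (ddpmG d α) lam
        (approxScore α eps t (u t ω)) (u q ω) q) volume t (t - r) := by
      refine hint.symm.mono_set ?_
      rw [Set.uIcc_of_ge (by linarith [hr.1]), Set.uIcc_of_ge (by linarith [hr.1, hr.2])]
      exact Set.Icc_subset_Icc_left (by linarith [hr.2])
    have hproj := (EuclideanSpace.proj (𝕜 := ℝ) i).intervalIntegral_comp_comm hint'
    have hsubst := intervalIntegral.integral_comp_sub_left (a := 0) (b := r)
      (fun q => lambdaDrift (ddpmF d α) (ddpmG d α) lam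
        (approxScore α eps t (u t ω)) (u q ω) q i) t
    rw [sub_zero] at hsubst
    calc _ = ∫ q in t..(t - r), lambdaDrift (ddpmF d α) (ddpmG d α) lam
          (approxScore α eps t (u t ω)) (u q ω) q i := hproj.symm
      _ = ∫ s in (0 : ℝ)..r, -lambdaDrift (ddpmF d α) (ddpmG d α) lam
          (approxScore α eps t (u t ω)) (u (t - s) ω) (t - s) i := by
        rw [intervalIntegral.integral_neg, hsubst, intervalIntegral.integral_symm]
      _ = _ := by
        -- The drifts are compared off the point `R`, since `G Gᵀ` is computed from `√γ * √γ = γ`,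
        -- which needs the sign of `γ`.
        refine intervalIntegral.integral_congr_ae ?_
        have hne : ∀ᵐ x : ℝ, x ≠ R := by simp [ae_iff, measure_singleton]
        filter_upwards [hne] with s hs hsr
        rw [Set.uIoc_of_le hr.1] at hsr
        have hs0 : s ∈ Set.Ioo 0 R := ⟨hsr.1, lt_of_le_of_ne (hsr.2.trans hr.2) hs⟩
        have hs1 : s ∈ Set.Icc 0 R := ⟨hs0.1.le, hs0.2.le⟩
        have hne1 : 1 - α (t - s) ≠ 0 := by linarith [hlt s hs1]
        rw [lambdaDrift_apply α lam _ _ (hclock.rate_nonneg s hs0), approxScore_apply α eps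
          (hα1 t ⟨by linarith, le_rfl⟩), rateFundamental, Real.exp_log (hpos s hs1), deviation,
          ← hy]
        simp only [hγ]
        field_simp
        ring
  rw [noisePart, hdrift, intervalIntegral.integral_add (hint1.mul_const y) hint2,
    intervalIntegral.integral_mul_const, hpart, deviation, deviation, ← hy]
  simp only [sub_zero]
  ring

/-- The joint characteristic function of the starting value and of the centered solution, away
from the end of the time interval. -/
lemma integral_cexp_solution [IsProbabilityMeasure P] (hα : IsDDPMSchedule α T)
    (hstart : 0 ≤ t - Δ) (hend : t ≤ T) (hαt : 0 < α t)
    (hα1 : ∀ τ ∈ Set.Ioc (t - Δ) t, α τ < 1)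
    (hu : IsLambdaSDESolution P (ddpmF d α) (ddpmG d α) lam
      (fun ω => approxScore α eps t (u t ω)) t Δ W u)
    {R : ℝ} (hR0 : 0 ≤ R) (hR : R < Δ) (ξ η : State d) :
    ∫ ω, Complex.exp ((inner ℝ ξ (u t ω) + inner ℝ η (u (t - R) ω -
      stepMean α eps (stepVar α lam t (t - R)) t (t - R) (u t ω)) : ℝ) * Complex.I) ∂P =
      (∫ ω, Complex.exp ((inner ℝ ξ (u t ω) : ℝ) * Complex.I) ∂P) *
        Complex.exp (-((‖η‖ ^ 2 * stepVar α lam t (t - R) / 2 : ℝ) : ℂ)) := by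
  have hclock := hα.isClock hstart hend hαt hR0 hR.le
  have hpos : ∀ r ∈ Set.Icc 0 R, 0 < α (t - r) := fun r hr =>
    hα.pos_of_le hend hαt (by linarith [hr.2]) (by linarith [hr.1])
  have hlt : ∀ r ∈ Set.Icc 0 R, α (t - r) < 1 := fun r hr =>
    hα1 _ ⟨by linarith [hr.2], by linarith [hr.1]⟩
  have hαt1 : α t < 1 := hα1 t ⟨by linarith, le_rfl⟩
  have hexp : ∀ r ∈ Set.Icc 0 R, Real.exp (Real.log (α (t - r))) < 1 := fun r hr => by
    rw [Real.exp_log (hpos r hr)]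
    exact hlt r hr
  have hexp0 : Real.exp (Real.log (α t)) < 1 := by rwa [Real.exp_log hαt]
  have hRmem : R ∈ Set.Icc 0 R := ⟨hR0, le_rfl⟩
  have hrate := continuousOn_rateFundamental_comp lam hclock.cont hexp
  set θ : ℝ → ℝ := logFundamental lam (Real.log (α t)) with hθ
  set γ : ℝ → ℝ := fun s => -deriv (fun q => Real.log (α q)) (t - s) with hγ
  set K : ℝ → ℝ := fun r => Real.exp (-θ (Real.log (α (t - r)))) with hK
  have hKc : ContinuousOn K (Set.Icc 0 R) := by
    refine ContinuousOn.rexp (ContinuousOn.neg fun r hr => ?_)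
    exact (hasDerivAt_logFundamental lam _ (hexp r hr)).continuousAt.comp_continuousWithinAt
      (f := fun r => Real.log (α (t - r))) (hclock.cont r hr)
  have hKa : ∀ r ∈ Set.Icc 0 R, ∫ s in (0 : ℝ)..r,
      -(K s * (rateFundamental lam (Real.log (α (t - s))) * γ s)) = K r - K 0 := by
    intro r hr
    have h := hclock.integral_comp (Ψ := fun l => Real.exp (-θ l))
      (ψ := fun l => Real.exp (-θ l) * -rateFundamental lam l)
      (fun s hs => (hasDerivAt_logFundamental lam _ (hexp s hs)).neg.exp)
      (hKc.mul hrate.neg) hr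
    rw [← h]
    refine intervalIntegral.integral_congr fun s _ => ?_
    simp only [hK]
    ring
  have hvar : ∫ s in (0 : ℝ)..R, K s ^ 2 * (lam ^ 2 * γ s) =
      varianceFundamental lam (Real.log (α t)) (Real.log (α (t - R))) -
        varianceFundamental lam (Real.log (α t)) (Real.log (α t)) := by
    have h := hclock.integral_comp (Ψ := varianceFundamental lam (Real.log (α t)))
      (ψ := fun l => lam ^ 2 * Real.exp (-θ l) ^ 2)
      (fun s hs => hasDerivAt_varianceFundamental lam hexp0 (hexp s hs))
      (continuousOn_const.mul (hKc.pow 2)) hRmem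
    rw [sub_zero] at h
    rw [← h]
    refine intervalIntegral.integral_congr fun s _ => ?_
    simp only [hK]
    ring
  have hpath : ∀ᵐ ω ∂P, ∀ i,
      ContinuousOn (fun r => deviation α t eps u i r ω) (Set.Icc 0 R) ∧
      ∀ r ∈ Set.Icc 0 R, noisePart α lam t eps u i r ω =
        deviation α t eps u i r ω - deviation α t eps u i 0 ω -
          ∫ s in (0 : ℝ)..r, deviation α t eps u i s ω *
            (rateFundamental lam (Real.log (α (t - s))) * γ s) := by
    filter_upwards [hu.continuous_paths, hu.drift_integrable] with ω h1 h2 i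
    exact noisePart_eq hα hend hstart hαt hα1 hR0 hR h1 h2 i
  have hYm : AEMeasurable (fun ω => (inner ℝ ξ (u t ω) : ℝ)) P :=
    (measurable_const.inner measurable_id).comp_aemeasurable
      (hu.aemeasurable t ⟨by linarith, le_rfl⟩)
  have hY : IndepFun (fun ω => (inner ℝ ξ (u t ω) : ℝ)) (fun ω (r : ℝ≥0) => W r ω) P :=
    hu.indep_start.comp (φ := fun x => (inner ℝ ξ x : ℝ)) (ψ := id)
      (measurable_const.inner measurable_id) measurable_id
  -- The weights `exp(θ) η i` undo the factor `K R`, leaving `η` paired with the centered solution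
  -- itself.
  have hmain := integral_cexp_linear hu.brownian hYm hY hclock lam
    (hclock.intervalIntegrable_mul hrate) hKc hKa
    (hpath.mono fun ω h i => (h i).1) (hpath.mono fun ω h i => (h i).2)
    (fun i r hr => isIsonormalValue_noisePart hu hR.le hclock i hr)
    (fun i => Real.exp (θ (Real.log (α (t - R)))) * η i)
  have hK0 : K 0 = 1 := by
    simp only [hK, hθ, sub_zero, logFundamental_self, neg_zero, Real.exp_zero]
  have hKR : Real.exp (θ (Real.log (α (t - R)))) * K R = 1 := by
    simp only [hK]
    rw [← Real.exp_add, add_neg_cancel, Real.exp_zero]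
  have hsq := exp_logFundamental_mul_sqrt α lam hαt hαt1 (hpos R hRmem) (hlt R hRmem)
  have hv := sq_exp_logFundamental_mul_variance α lam hαt hαt1 (hpos R hRmem) (hlt R hRmem)
  rw [← hθ] at hsq hv
  rw [hvar] at hmain
  have hdev0 : ∀ i ω, deviation α t eps u i 0 ω = √(1 - α t) * eps (u t ω) t i := by
    intro i ω
    rw [deviation, sub_zero, div_self hαt.ne', Real.sqrt_one]
    ring
  have hexpo : ∀ ω, ∑ i, Real.exp (θ (Real.log (α (t - R)))) * η i *
      (K R * deviation α t eps u i R ω - K 0 * deviation α t eps u i 0 ω) =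
      inner ℝ η (u (t - R) ω -
        stepMean α eps (stepVar α lam t (t - R)) t (t - R) (u t ω)) := by
    intro ω
    rw [PiLp.inner_apply]
    refine Finset.sum_congr rfl fun i _ => ?_
    simp only [stepMean, PiLp.sub_apply, PiLp.add_apply, PiLp.smul_apply, smul_eq_mul,
      RCLike.inner_apply, conj_trivial, hK0, hdev0]
    rw [← hsq, deviation]
    linear_combination (η i * (u (t - R) ω i - √(α (t - R) / α t) *
      (u t ω i - √(1 - α t) * eps (u t ω) t i))) * hKR
  simp_rw [hexpo] at hmain
  have hnorm : ∑ i, (Real.exp (θ (Real.log (α (t - R)))) * η i) ^ 2 =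
      ‖η‖ ^ 2 * Real.exp (θ (Real.log (α (t - R)))) ^ 2 := by
    rw [EuclideanSpace.norm_sq_eq, Finset.sum_mul]
    refine Finset.sum_congr rfl fun i _ => ?_
    rw [Real.norm_eq_abs, sq_abs]
    ring
  rw [hmain, hnorm, mul_assoc, hv]

end Solution

/-! ### The DDIM kernel, and identification of laws by characteristic functions -/

/-- The distribution of one stochastic DDIM step, as a kernel. -/
noncomputable def ddimKernel {d : ℕ} (α : ℝ → ℝ) (eps : State d → ℝ → State d) (sigma t t' : ℝ) :
    Kernel (State d) (State d) :=
  (Kernel.id ×ₖ Kernel.const (State d) (stdGaussian (State d))).map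
    fun p => ddimUpdate α eps sigma t t' p.1 p.2

lemma measurable_ddimUpdate {d : ℕ} (α : ℝ → ℝ) {eps : State d → ℝ → State d} (sigma : ℝ) {t : ℝ}
    (t' : ℝ) (heps : Measurable fun x => eps x t) :
    Measurable fun p : State d × State d => ddimUpdate α eps sigma t t' p.1 p.2 := by
  have : Measurable fun p : State d × State d => eps p.1 t := heps.comp measurable_fst
  unfold ddimUpdate
  fun_prop

lemma ddimKernel_apply {d : ℕ} (α : ℝ → ℝ) {eps : State d → ℝ → State d} (sigma : ℝ) {t : ℝ}
    (t' : ℝ) (heps : Measurable fun x => eps x t) (y : State d) :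
    ddimKernel α eps sigma t t' y =
      (stdGaussian (State d)).map (ddimUpdate α eps sigma t t' y) := by
  have hm := measurable_ddimUpdate α sigma t' heps
  rw [ddimKernel, Kernel.map_apply _ hm, Kernel.prod_apply, Kernel.id_apply, Kernel.const_apply,
    Measure.dirac_prod, Measure.map_map hm (by fun_prop)]
  rfl

lemma ddimUpdate_eq {d : ℕ} (α : ℝ → ℝ) (eps : State d → ℝ → State d) {v : ℝ} (hv : 0 ≤ v)
    (t t' : ℝ) (y z : State d) :
    ddimUpdate α eps (√v) t t' y z = stepMean α eps v t t' y + √v • z := by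
  rw [ddimUpdate, stepMean, Real.sq_sqrt hv, mul_comm (√(1 - α t)), sub_eq_neg_add]

open scoped MatrixOrder Matrix.Norms.L2Operator in
lemma multivariateGaussian_smul_one {d : ℕ} (m : State d) {v : ℝ} (hv : 0 ≤ v) :
    multivariateGaussian m (v • (1 : Matrix (Fin d) (Fin d) ℝ)) =
      (stdGaussian (State d)).map fun z => m + √v • z := by
  -- By uniqueness of the nonnegative square root.
  have hsqrt : CFC.sqrt (v • (1 : Matrix (Fin d) (Fin d) ℝ)) =
      √v • (1 : Matrix (Fin d) (Fin d) ℝ) := by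
    refine CFC.sqrt_unique ?_
      (Matrix.nonneg_iff_posSemidef.2 (Matrix.PosSemidef.one.smul (Real.sqrt_nonneg v)))
    rw [Matrix.smul_mul, Matrix.mul_smul, smul_smul, Real.mul_self_sqrt hv, Matrix.one_mul]
  rw [multivariateGaussian, hsqrt]
  simp

/-- If `Y` has the law of `√v` times a standard Gaussian and is independent of `X`, as read off
from the joint characteristic function, then `X` and `Y` are as in the product measure. -/
lemma map_prodMk_eq_prod_of_integral_cexp {Ω : Type*} [MeasurableSpace Ω] {P : Measure Ω}
    [IsProbabilityMeasure P] {d : ℕ} {X Y : Ω → State d} (hX : AEMeasurable X P)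
    (hY : AEMeasurable Y P) {v : ℝ} (hv : 0 ≤ v)
    (h : ∀ ξ η : State d,
      ∫ ω, Complex.exp ((inner ℝ ξ (X ω) + inner ℝ η (Y ω) : ℝ) * Complex.I) ∂P =
        (∫ ω, Complex.exp ((inner ℝ ξ (X ω) : ℝ) * Complex.I) ∂P) *
          Complex.exp (-((‖η‖ ^ 2 * v / 2 : ℝ) : ℂ))) :
    P.map (fun ω => (X ω, Y ω)) =
      (P.map X).prod ((stdGaussian (State d)).map fun z => √v • z) := by
  have hchar : ∀ {Z : Ω → State d}, AEMeasurable Z P → ∀ ξ, charFun (P.map Z) ξ =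
      ∫ ω, Complex.exp ((inner ℝ ξ (Z ω) : ℝ) * Complex.I) ∂P := by
    intro Z hZ ξ
    rw [charFun_apply, integral_map hZ (by fun_prop)]
    simp_rw [real_inner_comm ξ]
  have hYc : ∀ η, charFun (P.map Y) η = Complex.exp (-((‖η‖ ^ 2 * v / 2 : ℝ) : ℂ)) := by
    intro η
    -- At `ξ = 0` the joint formula gives the law of `Y`; fed back in, it becomes the product form
    -- that characterizes independence.
    have := h 0 η
    simpa [hchar hY] using this
  have hlaw : P.map Y = (stdGaussian (State d)).map fun z => √v • z := by
    have := Measure.isProbabilityMeasure_map hY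
    have : IsProbabilityMeasure ((stdGaussian (State d)).map fun z => √v • z) :=
      Measure.isProbabilityMeasure_map (by fun_prop)
    refine Measure.ext_of_charFun (funext fun η => ?_)
    rw [hYc, charFun_map_smul, charFun_stdGaussian, norm_smul, Real.norm_of_nonneg (by positivity)]
    congr 1
    have : ((√v : ℝ) : ℂ) ^ 2 = v := by rw [← Complex.ofReal_pow, Real.sq_sqrt hv]
    push_cast
    rw [mul_pow, this]
    ring
  have hind : IndepFun X Y P := by
    rw [indepFun_iff_charFun_prod hX hY]
    intro p
    rw [charFun_apply, integral_map (by fun_prop) (by fun_prop), hchar hX, hYc, ← h]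
    simp_rw [WithLp.prod_inner_apply, real_inner_comm]
  rw [(indepFun_iff_map_prod_eq_prod_map_map hX hY).1 hind, hlaw]

/-! ### Continuity of the step coefficients in the end time -/

section Limit

variable {α : ℝ → ℝ} {lam t t' : ℝ} {τ : ℕ → ℝ}

lemma tendsto_stepVar (h0 : 0 < α t')
    (h : Tendsto (fun n => α (τ n)) atTop (𝓝 (α t'))) :
    Tendsto (fun n => stepVar α lam t (τ n)) atTop (𝓝 (stepVar α lam t t')) := by
  have hc : ContinuousAt (fun q : ℝ => (1 - q) * (1 - ((1 - q) / (1 - α t)) ^ (lam ^ 2) *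
      (α t / q) ^ (lam ^ 2))) (α t') := by
    have h2 : ContinuousAt (fun q : ℝ => α t / q) (α t') :=
      continuousAt_const.div continuousAt_id h0.ne'
    have h3 : ContinuousAt (fun q : ℝ => (1 - q) / (1 - α t)) (α t') := by fun_prop
    -- The base vanishes when `α t' = 1`, so continuity is taken from the nonnegative exponent.
    have h4 := h3.rpow_const (p := lam ^ 2) (Or.inr (sq_nonneg lam))
    have h5 := h2.rpow_const (p := lam ^ 2) (Or.inr (sq_nonneg lam))
    exact (continuousAt_const.sub continuousAt_id).mul (continuousAt_const.sub (h4.mul h5))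
  exact hc.tendsto.comp h

lemma tendsto_stepMean {d : ℕ} (eps : State d → ℝ → State d) (h0 : 0 < α t')
    (h : Tendsto (fun n => α (τ n)) atTop (𝓝 (α t'))) (y : State d) :
    Tendsto (fun n => stepMean α eps (stepVar α lam t (τ n)) t (τ n) y) atTop
      (𝓝 (stepMean α eps (stepVar α lam t t') t t' y)) := by
  have hv := tendsto_stepVar (lam := lam) (t := t) h0 h
  have hs : Tendsto (fun n => √(α (τ n) / α t)) atTop (𝓝 (√(α t' / α t))) :=
    (h.div_const _).sqrt
  exact (hs.smul_const y).add
    (((hs.mul_const _).neg.add ((h.const_sub 1).sub hv).sqrt).smul_const _)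

end Limit

end DDIM

/-! ### The conditional law of the step -/

theorem mainTheorem1 {Ω : Type*} [MeasurableSpace Ω] (P : Measure Ω) [IsProbabilityMeasure P]
    (d : ℕ) (T : ℝ) (α : ℝ → ℝ) (hα : DDIM.IsDDPMSchedule α T)
    (lam : ℝ) (hlam : 0 ≤ lam)
    (t Δ : ℝ) (hΔ : 0 < Δ) (hstart : 0 ≤ t - Δ) (hend : t ≤ T)
    (hαt : 0 < α t) (hα1 : ∀ τ ∈ Set.Ioc (t - Δ) t, α τ < 1)
    (eps : DDIM.State d → ℝ → DDIM.State d) (heps : Measurable (fun x => eps x t))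
    (W : ℝ≥0 → Ω → DDIM.State d) (u : ℝ → Ω → DDIM.State d)
    (hu : DDIM.IsLambdaSDESolution P (DDIM.ddpmF d α) (DDIM.ddpmG d α) lam
      (fun ω => DDIM.approxScore α eps t (u t ω)) t Δ W u) :
    0 ≤ DDIM.stepVar α lam t (t - Δ) ∧
    0 ≤ 1 - α (t - Δ) - DDIM.stepVar α lam t (t - Δ) ∧
    ∃ κ : Kernel (DDIM.State d) (DDIM.State d),
      (∀ y, κ y = multivariateGaussian
        (DDIM.stepMean α eps (DDIM.stepVar α lam t (t - Δ)) t (t - Δ) y)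
        (DDIM.stepVar α lam t (t - Δ) • (1 : Matrix (Fin d) (Fin d) ℝ))) ∧
      (∀ y, κ y = (stdGaussian (DDIM.State d)).map
        (DDIM.ddimUpdate α eps (√(DDIM.stepVar α lam t (t - Δ))) t (t - Δ) y)) ∧
      HasCondDistrib (u (t - Δ)) (u t) κ P := by
  open DDIM in
  have hαt1 : α t < 1 := hα1 t ⟨by linarith, le_rfl⟩
  have hmemT : t - Δ ∈ Set.Icc 0 T := ⟨hstart, by linarith⟩
  have hle : α t ≤ α (t - Δ) := hα.antitone hmemT ⟨by linarith, hend⟩ (by linarith)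
  have hle1 : α (t - Δ) ≤ 1 := by
    rw [← hα.at_zero]
    exact hα.antitone ⟨le_rfl, hα.T_pos.le⟩ hmemT hstart
  have hpos : 0 < α (t - Δ) := hαt.trans_le hle
  have hv := stepVar_nonneg α lam hαt hαt1 hle hle1
  refine ⟨hv, stepVar_le α lam hαt hαt1 hle hle1, ?_⟩
  set v := stepVar α lam t (t - Δ) with hvdef
  have hupd : ∀ y, ddimUpdate α eps (√v) t (t - Δ) y =
      fun z => stepMean α eps v t (t - Δ) y + √v • z :=
    fun y => funext fun z => ddimUpdate_eq α eps hv t (t - Δ) y z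
  refine ⟨ddimKernel α eps (√v) t (t - Δ), fun y => ?_, ddimKernel_apply α _ _ heps, ?_⟩
  · rw [ddimKernel_apply α _ _ heps, multivariateGaussian_smul_one _ hv, hupd]
  have hmean : Measurable (stepMean α eps v t (t - Δ)) := by
    unfold stepMean
    fun_prop
  have hut : AEMeasurable (u t) P := hu.aemeasurable t ⟨by linarith, le_rfl⟩
  have hu' : ∀ τ ∈ Set.Icc (t - Δ) t, AEMeasurable (u τ) P := hu.aemeasurable
  have hY : AEMeasurable (fun ω => u (t - Δ) ω - stepMean α eps v t (t - Δ) (u t ω)) P :=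
    (hu' _ ⟨le_rfl, by linarith⟩).sub (hmean.comp_aemeasurable hut)
  -- let `R` increase to `Δ`
  set R : ℕ → ℝ := fun n => Δ - Δ / (n + 2) with hR
  have hRlim : Tendsto R atTop (𝓝 Δ) := by
    have h : Tendsto (fun n : ℕ => Δ / ((n : ℝ) + 2)) atTop (𝓝 0) :=
      tendsto_const_nhds.div_atTop (tendsto_atTop_add_const_right _ _ tendsto_natCast_atTop_atTop)
    simpa using h.const_sub Δ
  have hRlt : ∀ n, R n < Δ := fun n => by
    have : 0 < Δ / ((n : ℝ) + 2) := by positivity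
    simp only [hR]
    linarith
  have hR0 : ∀ n, 0 ≤ R n := fun n => by
    have : Δ / ((n : ℝ) + 2) ≤ Δ := div_le_self hΔ.le (by linarith [n.cast_nonneg (α := ℝ)])
    simp only [hR]
    linarith
  have hRmem : ∀ n, t - R n ∈ Set.Icc (t - Δ) t := fun n =>
    ⟨by linarith [hRlt n], by linarith [hR0 n]⟩
  have hτ : Tendsto (fun n => t - R n) atTop (𝓝[Set.Icc (t - Δ) t] (t - Δ)) :=
    tendsto_nhdsWithin_iff.2 ⟨hRlim.const_sub t, Eventually.of_forall hRmem⟩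
  have hαlim : Tendsto (fun n => α (t - R n)) atTop (𝓝 (α (t - Δ))) :=
    ((hα.continuous _ hmemT).mono (Set.Icc_subset_Icc hstart hend)).tendsto.comp hτ
  have hchar : ∀ ξ η : State d, ∫ ω, Complex.exp ((inner ℝ ξ (u t ω) + inner ℝ η
      (u (t - Δ) ω - stepMean α eps v t (t - Δ) (u t ω)) : ℝ) * Complex.I) ∂P =
      (∫ ω, Complex.exp ((inner ℝ ξ (u t ω) : ℝ) * Complex.I) ∂P) *
        Complex.exp (-((‖η‖ ^ 2 * v / 2 : ℝ) : ℂ)) := by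
    intro ξ η
    have hn := fun n => integral_cexp_solution hα hstart hend hαt hα1 hu (hR0 n) (hRlt n) ξ η
    have hlhs : Tendsto (fun n => ∫ ω, Complex.exp ((inner ℝ ξ (u t ω) + inner ℝ η
        (u (t - R n) ω - stepMean α eps (stepVar α lam t (t - R n)) t (t - R n) (u t ω)) : ℝ) *
          Complex.I) ∂P) atTop (𝓝 (∫ ω, Complex.exp ((inner ℝ ξ (u t ω) + inner ℝ η
        (u (t - Δ) ω - stepMean α eps v t (t - Δ) (u t ω)) : ℝ) * Complex.I) ∂P)) := by
      refine tendsto_integral_cexp_of_ae (fun n => ?_) ?_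
      · have h1 : Measurable (stepMean α eps (stepVar α lam t (t - R n)) t (t - R n)) := by
          unfold stepMean
          fun_prop
        have h2 : AEMeasurable (fun ω => u (t - R n) ω -
            stepMean α eps (stepVar α lam t (t - R n)) t (t - R n) (u t ω)) P :=
          (hu' _ (hRmem n)).sub (h1.comp_aemeasurable hut)
        exact (aemeasurable_const.inner hut).add (aemeasurable_const.inner h2)
      · filter_upwards [hu.continuous_paths] with ω hω
        refine Tendsto.const_add _ (Tendsto.inner tendsto_const_nhds (Tendsto.sub ?_
          (tendsto_stepMean eps hpos hαlim _)))
        exact (hω (t - Δ) ⟨le_rfl, by linarith⟩).tendsto.comp hτ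
    have hrhs : Tendsto (fun n => (∫ ω, Complex.exp ((inner ℝ ξ (u t ω) : ℝ) * Complex.I) ∂P) *
        Complex.exp (-((‖η‖ ^ 2 * stepVar α lam t (t - R n) / 2 : ℝ) : ℂ))) atTop
        (𝓝 ((∫ ω, Complex.exp ((inner ℝ ξ (u t ω) : ℝ) * Complex.I) ∂P) *
          Complex.exp (-((‖η‖ ^ 2 * v / 2 : ℝ) : ℂ)))) := by
      refine Tendsto.const_mul _ ?_
      have hcont : Continuous fun v : ℝ => Complex.exp (-((‖η‖ ^ 2 * v / 2 : ℝ) : ℂ)) := by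
        fun_prop
      exact (hcont.tendsto _).comp (tendsto_stepVar hpos hαlim)
    exact tendsto_nhds_unique hlhs (by simpa only [hn] using hrhs)
  have hjoint := map_prodMk_eq_prod_of_integral_cexp hut hY hv hchar
  -- recover `(u t, u (t - Δ))` from `(u t, Y)`
  have hΦ : Measurable fun p : State d × State d =>
      (p.1, stepMean α eps v t (t - Δ) p.1 + p.2) :=
    measurable_fst.prodMk ((hmean.comp measurable_fst).add measurable_snd)
  refine ⟨hut.prodMk (hu' _ ⟨le_rfl, by linarith⟩), ?_⟩
  have hmap : P.map (fun ω => (u t ω, u (t - Δ) ω)) =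
      (P.map fun ω => (u t ω, u (t - Δ) ω - stepMean α eps v t (t - Δ) (u t ω))).map
        fun p : State d × State d => (p.1, stepMean α eps v t (t - Δ) p.1 + p.2) := by
    rw [AEMeasurable.map_map_of_aemeasurable hΦ.aemeasurable (hut.prodMk hY)]
    congr 1
    ext ω : 1
    simp
  have hkm : IsMarkovKernel (ddimKernel α eps (√v) t (t - Δ)) :=
    Kernel.IsMarkovKernel.map _ (measurable_ddimUpdate α _ _ heps)
  have hprob := Measure.isProbabilityMeasure_map hut (μ := P)
  have hprob' : IsProbabilityMeasure ((stdGaussian (State d)).map fun z => √v • z) :=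
    Measure.isProbabilityMeasure_map (by fun_prop)
  rw [hmap, hjoint]
  -- Both sides are integrals over `y` of the measures of sections of `s`; on each section the
  -- product measure, shifted by the mean, is the kernel at `y`.
  ext s hs
  rw [Measure.map_apply hΦ hs, Measure.prod_apply (hΦ hs), Measure.compProd_apply hs]
  refine lintegral_congr fun y => ?_
  rw [ddimKernel_apply α _ _ heps, hupd,
    Measure.map_apply (by fun_prop) (measurable_prodMk_left (hΦ hs)),
    Measure.map_apply (by fun_prop) (measurable_prodMk_left hs)]
  rfl
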